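/- **Proposition (Roselle identities for $B_n$ and $D_n$).** Let $B_n$ be the group of signed permutations, i.e. of all bijections $\beta$ of $[-n,n]\setminus\{0\}$ with $\beta(-i)=-\beta(i)$, written $\beta=[\beta(1),\dots,\beta(n)]$, and let $D_n\subseteq B_n$ be the subgroup of those $\beta$ for which $|\{i\in[n]:\beta(i)<0\}|$ is even. Let $\ell_B$ be the length function of $B_n$ with respect to the generators $s_i=[1,\dots,i-1,i+1,i,i+2,\dots,n]$ $(1\le i\le n-1)$ and $s_0^B=[-1,2,\dots,n]$, and let $\ell_D$ be the length function of $D_n$ with respect to the generators $s_1,\dots,s_{n-1}$ and $s_0^D=[-2,-1,3,\dots,n]$ (the latter for $n\ge 2$). Put $\mathrm{Des}(\beta)=\{i\in[n-1]:\beta(i)>\beta(i+1)\}$ and define $$\mathrm{nmaj}(\beta)=\sum_{i\in \mathrm{Des}(\beta)} i+\sum_{i\in[n],\,\beta(i)<0}(-\beta(i))\quad(\beta\in B_n),\qquad \mathrm{dmaj}(\gamma)=\sum_{i\in \mathrm{Des}(\gamma)} i+\sum_{i\in[n],\,\gamma(i)<0}(-\gamma(i)-1)\quad(\gamma\in D_n),$$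 $$B_n(t,q)=\sum_{\beta\in B_n}t^{\mathrm{nmaj}(\beta)}q^{\ell_B(\beta)},\qquad D_n(t,q)=\sum_{\gamma\in D_n}t^{\mathrm{dmaj}(\gamma)}q^{\ell_D(\gamma)},$$ with $B_0(t,q)=1$. Let $(a;q)_n=\prod_{k=0}^{n-1}(1-aq^k)$ and $(u;t,q)_{\infty,\infty}=\prod_{i,j\ge 1}(1-u\,t^{i-1}q^{j-1})$. Then, in the ring $\mathbb Z[[t,q,u]]$ of formal power series with the topology of coefficientwise convergence, the series and the infinite product below converge, all denominators are invertible, and $$\sum_{n\ge 0}B_n(t,q)\frac{u^n}{(t;t)_n\,(q;q)_n\,(-qt;qt)_n}=\frac{1}{(u;t,q)_{\infty,\infty}},$$ $$1+\sum_{n\ge 1}D_n(t,q)\frac{u^n}{(t;t)_n\,(q;q)_n\,(-qt;qt)_{n-1}}=\frac{1}{(u;t,q)_{\infty,\infty}}.$$ -/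

import Mathlib

/-! ### Signed permutations -/

namespace SignedPerm

/-- The set `[-n, n] \ {0}` of nonzero integers of absolute value at most `n`. -/
abbrev Idx (n : ℕ) : Type := {x : ℤ // x ∈ (Finset.Icc (-(n : ℤ)) (n : ℤ)).erase 0}

instance instInvolutiveNegIdx (n : ℕ) : InvolutiveNeg (Idx n) where
  neg x := ⟨-x.1, by
    have h := x.2
    simp only [Finset.mem_erase, Finset.mem_Icc] at h ⊢
    omega⟩
  neg_neg x := Subtype.ext (neg_neg x.1)

/-- The hyperoctahedral group `B_n`: all bijections `β` of `[-n, n] \ {0}` onto itself with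
`β (-i) = -β i` for all `i`, under composition. -/
def B (n : ℕ) : Subgroup (Equiv.Perm (Idx n)) where
  carrier := {β | ∀ i, β (-i) = -β i}
  one_mem' := fun _ => rfl
  mul_mem' := by
    intro a b ha hb i
    change a (b (-i)) = -a (b i)
    rw [hb, ha]
  inv_mem' := by
    intro a ha i
    apply a.injective
    rw [ha]
    simp

noncomputable instance instDecidableMemB (n : ℕ) : DecidablePred (fun β => β ∈ B n) := fun β =>
  inferInstanceAs (Decidable (∀ i, β (-i) = -β i))

/-- The value `β(i)`, as an integer; it is used only for `i ∈ [-n, n] \ {0}`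
(and set to `0` for other `i`). -/
noncomputable def val {n : ℕ} (β : B n) (i : ℤ) : ℤ :=
  if h : i ∈ (Finset.Icc (-(n : ℤ)) (n : ℤ)).erase 0 then (β.1 ⟨i, h⟩).1 else 0

/-- The window notation of `β` is `[w 1, …, w n]`. -/
noncomputable def HasWindow {n : ℕ} (β : B n) (w : ℕ → ℤ) : Prop :=
  ∀ j ∈ Finset.Icc 1 n, val β j = w j

/-- The positions `i ∈ [n]` with `β(i) < 0`. -/
noncomputable def negPos {n : ℕ} (β : B n) : Finset ℕ :=
  (Finset.Icc 1 n).filter fun i => val β i < 0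

/-- `N_1(β)`, the number of negative entries in the window of `β`. -/
noncomputable def N₁ {n : ℕ} (β : B n) : ℕ := (negPos β).card

/-- The even-signed permutation group `D_n`, as the set of those elements of `B_n` that have an
even number of negative entries in their window notation. -/
noncomputable def D (n : ℕ) : Finset (B n) := Finset.univ.filter fun γ => N₁ γ % 2 = 0

/-! ### Generators and length -/

/-- `s` is the generator `s_i = [1, …, i-1, i+1, i, i+2, …, n]`. -/
noncomputable def IsAdjTransposition {n : ℕ} (i : ℕ) (s : B n) : Prop :=
  HasWindow s fun j => if j = i then (i : ℤ) + 1 else if j = i + 1 then (i : ℤ) else (j : ℤ)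

/-- The Coxeter generators of `B_n`: `s_1, …, s_{n-1}` and, for `n ≥ 1`,
`s_0^B = [-1, 2, …, n]`. -/
noncomputable def genB (n : ℕ) : Set (B n) :=
  {s | (∃ i : ℕ, 1 ≤ i ∧ i + 1 ≤ n ∧ IsAdjTransposition i s) ∨
    (1 ≤ n ∧ HasWindow s fun j => if j = 1 then -1 else (j : ℤ))}

/-- The Coxeter generators of `D_n`: `s_1, …, s_{n-1}` and, for `n ≥ 2`,
`s_0^D = [-2, -1, 3, …, n]`. -/
noncomputable def genD (n : ℕ) : Set (B n) :=
  {s | (∃ i : ℕ, 1 ≤ i ∧ i + 1 ≤ n ∧ IsAdjTransposition i s) ∨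
    (2 ≤ n ∧ HasWindow s fun j => if j = 1 then -2 else if j = 2 then -1 else (j : ℤ))}

/-- The length of `g` with respect to `S`: the least `k` such that `g` is a product of `k`
elements of `S`. (The sets `S` used here consist of involutions.) -/
noncomputable def wordLength {G : Type*} [Group G] (S : Set G) (g : G) : ℕ :=
  sInf {k | ∃ l : List G, (∀ s ∈ l, s ∈ S) ∧ l.prod = g ∧ l.length = k}

/-- The length function `ℓ_B` of the Coxeter group `B_n`. -/
noncomputable def lengthB {n : ℕ} (β : B n) : ℕ := wordLength (genB n) β

/-- The length function `ℓ_D` of the Coxeter group `D_n` (used on `D_n` only). -/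
noncomputable def lengthD {n : ℕ} (γ : B n) : ℕ := wordLength (genD n) γ

/-! ### Negative major indices -/

/-- `Des(β) = {i ∈ [n-1] | β(i) > β(i+1)}`. -/
noncomputable def Des {n : ℕ} (β : B n) : Finset ℕ :=
  (Finset.Ico 1 n).filter fun i => val β i > val β (i + 1)

/-- The multiset `NDes(β) = Des(β) ⊎ {-β(i) | i ∈ [n], β(i) < 0}`. -/
noncomputable def NDes {n : ℕ} (β : B n) : Multiset ℕ :=
  (Des β).val + (negPos β).val.map fun i => (-val β i).toNat

/-- The negative major index of `β ∈ B_n`. -/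
noncomputable def nmaj {n : ℕ} (β : B n) : ℕ := (NDes β).sum

/-- The multiset `DDes(γ) = Des(γ) ⊎ {-γ(i) - 1 | i ∈ [n], γ(i) < 0} \ {0}`. -/
noncomputable def DDes {n : ℕ} (γ : B n) : Multiset ℕ :=
  (Des γ).val + ((negPos γ).val.map fun i => (-val γ i - 1).toNat).filter (· ≠ 0)

/-- The negative major index of `γ ∈ D_n`. -/
noncomputable def dmaj {n : ℕ} (γ : B n) : ℕ := (DDes γ).sum

/-! ### Generating functions -/

/-- `B_n(t, q) = ∑_{β ∈ B_n} t^{nmaj β} q^{ℓ_B β}`. -/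
noncomputable def genFunB {R : Type*} [CommRing R] (n : ℕ) (t q : R) : R :=
  ∑ β : B n, t ^ nmaj β * q ^ lengthB β

/-- `D_n(t, q) = ∑_{γ ∈ D_n} t^{dmaj γ} q^{ℓ_D γ}`. -/
noncomputable def genFunD {R : Type*} [CommRing R] (n : ℕ) (t q : R) : R :=
  ∑ γ ∈ D n, t ^ dmaj γ * q ^ lengthD γ

/-- `(a; q)_n = (1 - a) (1 - a q) ⋯ (1 - a q^{n-1})`. -/
noncomputable def qPoch {R : Type*} [CommRing R] (a q : R) (n : ℕ) : R :=
  ∏ k ∈ Finset.range n, (1 - a * q ^ k)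

/-- The ring `ℤ⟦t, q, u⟧` of formal power series in three variables. It is given the topology of
coefficientwise convergence (`ℤ` being discrete). -/
abbrev Ser : Type := MvPowerSeries (Fin 3) ℤ

/-- The variable `t`. -/
noncomputable def t : Ser := MvPowerSeries.X 0

/-- The variable `q`. -/
noncomputable def q : Ser := MvPowerSeries.X 1

/-- The variable `u`. -/
noncomputable def u : Ser := MvPowerSeries.X 2

/-- The factor `1 - a x^i y^j` of `(a; x, y)_{∞,∞}`, with `i, j ≥ 0`. -/
noncomputable def biFactor {R : Type*} [CommRing R] (a x y : R) (p : ℕ × ℕ) : R :=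
  1 - a * x ^ p.1 * y ^ p.2

open scoped MvPowerSeries.WithPiTopology in
/-- `(a; x, y)_{∞,∞} = ∏_{i, j ≥ 1} (1 - a x^{i-1} y^{j-1})` in `ℤ⟦t, q, u⟧`. -/
noncomputable def biPochInf (a x y : Ser) : Ser := ∏' p : ℕ × ℕ, biFactor a x y p

/-- The denominator `(t; t)_n (q; q)_n (-qt; qt)_n`. -/
noncomputable def denomB (n : ℕ) : Ser :=
  qPoch t t n * qPoch q q n * qPoch (-(q * t)) (q * t) n

/-- The denominator `(t; t)_n (q; q)_n (-qt; qt)_{n-1}`, for `n ≥ 1`. -/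
noncomputable def denomD (n : ℕ) : Ser :=
  qPoch t t n * qPoch q q n * qPoch (-(q * t)) (q * t) (n - 1)

end SignedPerm

open scoped MvPowerSeries.WithPiTopology

namespace SignedPerm

/-! A signed permutation is determined by the set `A` of absolute values of its negative entries and
the relative order `π` of its window. Descents and inversions of the window see only `π`. Both
`nmaj` and `ℓ_B` add `∑ a` over `A` to the corresponding statistic of `π`, and on `D_n` both `dmaj`
and `ℓ_D` add `∑ (a - 1)`. Hence `B_n(t,q) = (-qt;qt)_n S_n(t,q)`, where `S_n` is the joint
generating function of `maj` and `inv` over permutations (`sum_B_eq`, `genFunB_eq`). On `D_n` the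
letter `1` adds nothing and only adjusts the parity, so the factor is `(-qt;qt)_{n-1}`
(`genFunD_eq`). Both identities thus reduce to the one for `S_n` (`hasSum_genFunS`).

For that one, let `F(X) = ∑ S_n X^n / ((t;t)_n (q;q)_n)` and `G(X) = ∑ X^n / (q;q)_n`. Then `G(qX) =
(1 - X) G(X)`, and `F(X) = F(tX) G(X)`; iterating both yields the double product
(`mul_biPochInf_eq_one`). The equation for `F` is a recurrence for `S_n`, obtained by refining `S_n`
by the last letter and solving the refined recurrence with Gaussian binomials (`partialSum_eq`).

The length formulas follow from a criterion for word length (`wordLength_eq`) and a count of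
inverted pairs in `[-n, n] \ {0}`, on which a generator acts transparently (`card_invPairs`). -/

/-! ### The infinite product from two functional equations -/

open PowerSeries in
theorem rescale_sub_one_dvd {R : Type*} [CommRing R] (a : R) (F : PowerSeries R)
    (h : coeff 0 F = 1) : C a ∣ rescale a F - 1 := by
  refine ⟨PowerSeries.mk fun n => if n = 0 then 0 else a ^ (n - 1) * coeff n F, ?_⟩
  ext n
  rcases n with _ | n
  · rw [map_sub, coeff_rescale, h]
    simp
  · simp [coeff_rescale, coeff_one, pow_succ']
    ring

theorem qPoch_succ {R : Type*} [CommRing R] (a q : R) (n : ℕ) :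
    qPoch a q (n + 1) = qPoch a q n * (1 - a * q ^ n) :=
  Finset.prod_range_succ _ _

-- Iterating the first equation gives `F(X) = F(t^I X) ∏ G(t^i X)`; iterating the second, each
-- factor `1 - a q^j X` moves `G(a q^j X)` to `G(a q^(j+1) X)`.
open PowerSeries in
theorem mul_prod_eq_of_rescale {R : Type*} [CommRing R] (t q : R) (F G : PowerSeries R)
    (hF : F = rescale t F * G) (hG : rescale q G = (1 - X) * G) (I J : ℕ) :
    F * ∏ i ∈ Finset.range I, ∏ j ∈ Finset.range J, (1 - C (t ^ i * q ^ j) * X) =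
      rescale (t ^ I) F * ∏ i ∈ Finset.range I, rescale (t ^ i * q ^ J) G := by
  have h1 : ∀ I, F = rescale (t ^ I) F * ∏ i ∈ Finset.range I, rescale (t ^ i) G := by
    intro I
    induction I with
    | zero => simp
    | succ I ih =>
      have h := congrArg (rescale (t ^ I)) hF
      rw [map_mul, rescale_rescale, ← pow_succ'] at h
      rw [Finset.prod_range_succ]
      conv_lhs => rw [ih, h]
      ring
  have h2 : ∀ i J, rescale (t ^ i) G * ∏ j ∈ Finset.range J, (1 - C (t ^ i * q ^ j) * X) =
      rescale (t ^ i * q ^ J) G := by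
    intro i J
    induction J with
    | zero => simp
    | succ J ih =>
      rw [Finset.prod_range_succ, ← mul_assoc, ih]
      have h := congrArg (rescale (t ^ i * q ^ J)) hG
      rw [map_mul, rescale_rescale, map_sub, map_one, rescale_X] at h
      rw [pow_succ, ← mul_assoc, mul_comm _ q, h]
      ring
  conv_lhs => rw [h1 I]
  rw [mul_assoc, ← Finset.prod_mul_distrib]
  simp_rw [h2]

-- A series with constant term `1`, rescaled by `a`, is `1` modulo `a`. So the truncated product
-- inverts `F` up to the ideal generated by `t^I` and `q^J`.
open PowerSeries in
theorem exists_mul_prod_eq {R : Type*} [CommRing R] (t q : R) (F G : PowerSeries R)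
    (hF : F = rescale t F * G) (hG : rescale q G = (1 - X) * G)
    (hF0 : coeff 0 F = 1) (hG0 : coeff 0 G = 1) (I J : ℕ) :
    ∃ A B, F * ∏ i ∈ Finset.range I, ∏ j ∈ Finset.range J, (1 - C (t ^ i * q ^ j) * X) =
      1 + C (t ^ I) * A + C (q ^ J) * B := by
  rw [mul_prod_eq_of_rescale t q F G hF hG]
  obtain ⟨A, hA⟩ := rescale_sub_one_dvd (t ^ I) F hF0
  have : C (q ^ J) ∣ (∏ i ∈ Finset.range I, rescale (t ^ i * q ^ J) G) - 1 := by
    refine Finset.prod_induction _ (fun x => C (q ^ J) ∣ x - 1) ?_ (by simp) ?_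
    · rintro a b ⟨a', ha⟩ ⟨b', hb⟩
      exact ⟨a' * b + b', by linear_combination b * ha + hb⟩
    · intro i _
      refine dvd_trans ?_ (rescale_sub_one_dvd _ G hG0)
      rw [map_mul]
      exact dvd_mul_left _ _
  obtain ⟨B, hB⟩ := this
  refine ⟨A * ∏ i ∈ Finset.range I, rescale (t ^ i * q ^ J) G, B, ?_⟩
  linear_combination (∏ i ∈ Finset.range I, rescale (t ^ i * q ^ J) G) * hA + hB

theorem hasEval_u : PowerSeries.HasEval u := by
  apply MvPowerSeries.WithPiTopology.isTopologicallyNilpotent_of_constantCoeff_zero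
  simp [u]

/-- Evaluation at `u` of power series with coefficients in `ℤ⟦t, q, u⟧`. -/
noncomputable def evalU : PowerSeries Ser →ₐ[Ser] Ser := PowerSeries.aeval hasEval_u

theorem hasSum_evalU (F : PowerSeries Ser) :
    HasSum (fun n => PowerSeries.coeff n F * u ^ n) (evalU F) :=
  PowerSeries.hasSum_aeval hasEval_u F

theorem evalU_C (a : Ser) : evalU (PowerSeries.C a) = a :=
  evalU.commutes a

theorem evalU_X : evalU PowerSeries.X = u := by
  refine (hasSum_evalU _).unique ?_
  convert hasSum_single (f := fun n => PowerSeries.coeff n (PowerSeries.X : PowerSeries Ser) * u ^ n)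
    1 ?_ using 1
  · simp
  · intro n hn
    simp [PowerSeries.coeff_X, hn]

theorem multipliable_biFactor : Multipliable (biFactor u t q) := by
  rw [← Nat.pairEquiv.symm.multipliable_iff]
  have : (biFactor u t q ∘ Nat.pairEquiv.symm) =
      fun n => 1 + -(u * t ^ n.unpair.1 * q ^ n.unpair.2) := by
    ext1 n
    simp [biFactor, sub_eq_add_neg]
  rw [this]
  apply MvPowerSeries.WithPiTopology.multipliable_one_add_of_tendsto_order_atTop_nhds_top
  simp_rw [ENat.tendsto_nhds_top_iff_natCast_lt, Filter.eventually_atTop]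
  intro N
  -- The pairing sends `(i, j)` below `(max i j + 1)^2`, so an index this large forces `max i j ≥
  -- N`, and the monomial `u t^i q^j` has degree `1 + i + j > N`.
  refine ⟨(N + 1) ^ 2, fun n hn => ?_⟩
  have h1 := Nat.pair_lt_max_add_one_sq n.unpair.1 n.unpair.2
  rw [Nat.pair_unpair] at h1
  have h2 : N < max n.unpair.1 n.unpair.2 + 1 := by
    by_contra h
    have := Nat.pow_le_pow_left (Nat.le_of_not_lt h) 2
    have := Nat.pow_le_pow_left (Nat.le_succ N) 2
    rw [Nat.succ_eq_add_one] at this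
    omega
  have h3 : N < 1 + n.unpair.1 + n.unpair.2 := by
    omega
  refine lt_of_lt_of_le (ENat.natCast_lt_natCast.mpr h3) ?_
  have : -(u * t ^ n.unpair.1 * q ^ n.unpair.2) = MvPowerSeries.monomial
      (Finsupp.single 2 1 + Finsupp.single 0 n.unpair.1 + Finsupp.single 1 n.unpair.2) (-1) := by
    rw [u, t, q, MvPowerSeries.X_pow_eq, MvPowerSeries.X_pow_eq, MvPowerSeries.X,
      MvPowerSeries.monomial_mul_monomial, MvPowerSeries.monomial_mul_monomial, map_neg]
    simp
  rw [this, MvPowerSeries.order_monomial]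
  simp [map_add, Finsupp.degree_single]

theorem tendsto_range_product :
    Filter.Tendsto (fun I : ℕ => Finset.range I ×ˢ Finset.range I) Filter.atTop Filter.atTop := by
  apply Filter.tendsto_atTop_finset_of_monotone
  · intro a b h
    exact Finset.product_subset_product (Finset.range_mono h) (Finset.range_mono h)
  · rintro ⟨a, b⟩
    exact ⟨max a b + 1, by simp⟩

theorem coeff_X_pow_mul_eq_zero {σ R : Type*} [CommSemiring R] (s : σ) {n : ℕ} {d : σ →₀ ℕ}
    (φ : MvPowerSeries σ R) (h : d s < n) :
    MvPowerSeries.coeff d (MvPowerSeries.X s ^ n * φ) = 0 :=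
  MvPowerSeries.X_pow_dvd_iff.mp (dvd_mul_right _ _) d h

/-- `X` is kept apart from `u` so that `u ↦ tu` is a rescaling; `X = u` is substituted only at the
end. Along square truncations, a fixed coefficient of the error terms vanishes once `I` exceeds the
exponents of `t` and `q`. -/
theorem mul_biPochInf_eq_one (F G : PowerSeries Ser)
    (hF : F = PowerSeries.rescale t F * G)
    (hG : PowerSeries.rescale q G = (1 - PowerSeries.X) * G)
    (hF0 : PowerSeries.coeff 0 F = 1) (hG0 : PowerSeries.coeff 0 G = 1) :
    evalU F * biPochInf u t q = 1 := by
  have h1 : Filter.Tendsto (fun I : ℕ => evalU F *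
      ∏ p ∈ Finset.range I ×ˢ Finset.range I, biFactor u t q p) Filter.atTop
      (nhds (evalU F * biPochInf u t q)) :=
    (multipliable_biFactor.hasProd.comp tendsto_range_product).const_mul (evalU F)
  refine tendsto_nhds_unique h1 ?_
  rw [MvPowerSeries.WithPiTopology.tendsto_iff_coeff_tendsto]
  intro d
  apply tendsto_const_nhds.congr'
  filter_upwards [Filter.eventually_gt_atTop (d 0), Filter.eventually_gt_atTop (d 1)] with I h0 h1
  obtain ⟨A, B, h⟩ := exists_mul_prod_eq t q F G hF hG hF0 hG0 I I
  have h := congrArg evalU h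
  simp only [map_mul, map_prod, map_sub, map_one, map_add, evalU_C, evalU_X] at h
  have e : evalU F * ∏ p ∈ Finset.range I ×ˢ Finset.range I, biFactor u t q p =
      1 + t ^ I * evalU A + q ^ I * evalU B := by
    rw [Finset.prod_product, ← h]
    refine congrArg (evalU F * ·)
      (Finset.prod_congr rfl fun i _ => Finset.prod_congr rfl fun j _ => ?_)
    rw [biFactor]
    ring
  have e0 : MvPowerSeries.coeff d (t ^ I * evalU A) = 0 := coeff_X_pow_mul_eq_zero 0 _ h0
  have e1 : MvPowerSeries.coeff d (q ^ I * evalU B) = 0 := coeff_X_pow_mul_eq_zero 1 _ h1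
  rw [e, map_add, map_add, e0, e1, add_zero, add_zero]

theorem isUnit_qPoch {a q : Ser} (h : MvPowerSeries.constantCoeff a = 0) (n : ℕ) :
    IsUnit (qPoch a q n) := by
  rw [MvPowerSeries.isUnit_iff_constantCoeff, qPoch, map_prod]
  simp [h]

/-- The recurrence is the coefficient form of `F(X) = F(tX) G(X)` with `G = ∑ X^n / (q;q)_n`. -/
theorem hasSum_of_recurrence (c : ℕ → Ser) (h0 : c 0 = 1)
    (hc : ∀ n, c n = ∑ p ∈ Finset.HasAntidiagonal.antidiagonal n,
      t ^ p.1 * c p.1 * Ring.inverse (qPoch q q p.2)) :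
    IsUnit (biPochInf u t q) ∧
      HasSum (fun n => c n * u ^ n) (Ring.inverse (biPochInf u t q)) := by
  have hq : ∀ n, IsUnit (qPoch q q n) := isUnit_qPoch (by simp [q])
  have key := mul_biPochInf_eq_one (PowerSeries.mk c)
    (PowerSeries.mk fun n => Ring.inverse (qPoch q q n)) ?_ ?_ (by simpa using h0) (by simp [qPoch])
  · have hu : IsUnit (biPochInf u t q) := IsUnit.of_mul_eq_one_right _ key
    refine ⟨hu, ?_⟩
    have : Ring.inverse (biPochInf u t q) = evalU (PowerSeries.mk c) := by
      rw [← mul_one (Ring.inverse _), ← key, mul_comm (evalU _), ← mul_assoc,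
        Ring.inverse_mul_cancel _ hu, one_mul]
    rw [this]
    simpa using hasSum_evalU (PowerSeries.mk c)
  · ext1 n
    simp only [PowerSeries.coeff_mul, PowerSeries.coeff_rescale, PowerSeries.coeff_mk]
    exact hc n
  · ext1 n
    rcases n with _ | n
    · simp [PowerSeries.coeff_rescale]
    · rw [sub_mul, one_mul, map_sub, PowerSeries.coeff_succ_X_mul, PowerSeries.coeff_rescale,
        PowerSeries.coeff_mk, PowerSeries.coeff_mk]
      have h1 := Ring.inverse_mul_cancel _ (hq n)
      have h2 := Ring.inverse_mul_cancel _ (hq (n + 1))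
      have h3 := qPoch_succ q q n
      linear_combination (Ring.inverse (qPoch q q (n + 1)) * (1 - q * q ^ n)) * h1 -
        Ring.inverse (qPoch q q n) * h2 + Ring.inverse (qPoch q q n) * Ring.inverse (qPoch q q (n + 1)) * h3

/-! ### Solving the recurrence refined by the last letter -/

section Recurrence

variable {R : Type*} [CommRing R]

/-- The Gaussian binomial coefficient. -/
def gaussBinom (q : R) : ℕ → ℕ → R
  | _, 0 => 1
  | 0, _ + 1 => 0
  | n + 1, k + 1 => gaussBinom q n k + q ^ (k + 1) * gaussBinom q n (k + 1)

theorem gaussBinom_zero_right (q : R) (n : ℕ) : gaussBinom q n 0 = 1 := by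
  cases n <;> rfl

theorem gaussBinom_succ_succ (q : R) (n k : ℕ) : gaussBinom q (n + 1) (k + 1) =
    gaussBinom q n k + q ^ (k + 1) * gaussBinom q n (k + 1) := rfl

theorem gaussBinom_of_lt (q : R) {n k : ℕ} (h : n < k) : gaussBinom q n k = 0 := by
  induction n generalizing k with
  | zero =>
    obtain ⟨k, rfl⟩ := Nat.exists_eq_add_of_lt h
    rfl
  | succ n ih =>
    obtain ⟨k, rfl⟩ : ∃ l, k = l + 1 := ⟨k - 1, by omega⟩
    rw [gaussBinom_succ_succ, ih (by omega), ih (by omega)]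
    simp

theorem gaussBinom_self (q : R) (n : ℕ) : gaussBinom q n n = 1 := by
  induction n with
  | zero => rfl
  | succ n ih =>
    rw [gaussBinom_succ_succ, ih, gaussBinom_of_lt q (Nat.lt_succ_self n)]
    simp

theorem gaussBinom_mul_qPoch (q : R) (m k : ℕ) :
    gaussBinom q (m + k) k * (qPoch q q k * qPoch q q m) = qPoch q q (m + k) := by
  induction k generalizing m with
  | zero => simp [gaussBinom_zero_right, qPoch]
  | succ k ih =>
    induction m with
    | zero => simp [gaussBinom_self, qPoch]
    | succ m ihm =>
      have e : m + 1 + (k + 1) = (m + (k + 1)) + 1 := by ring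
      have h := ih (m + 1)
      rw [show m + 1 + k = m + (k + 1) by ring] at h
      rw [e, gaussBinom_succ_succ]
      rw [qPoch_succ q q m] at h ⊢
      rw [qPoch_succ q q k] at ihm ⊢
      rw [qPoch_succ q q (m + (k + 1))]
      linear_combination (1 - q * q ^ k) * h + q ^ (k + 1) * (1 - q * q ^ m) * ihm

/-- `A n i` stands for the part of `S n` with last letter less than `i`. Unrolling the recurrence in
`n` reaches `S (n - 1 - k)` after `k` factors `1 - t^m`; the iterated sums over last letters become
Gaussian binomials. -/
theorem partialSum_eq (t q : R) (A : ℕ → ℕ → R) (S : ℕ → R) (h0 : ∀ n, A n 0 = 0)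
    (hA : ∀ n i, i ≤ n →
      A (n + 1) (i + 1) = A (n + 1) i + q ^ (n - i) * (t ^ n * S n + (1 - t ^ n) * A n i))
    (n i : ℕ) (hi : i ≤ n) :
    A n i = ∑ k ∈ Finset.range n, t ^ (n - 1 - k) * (∏ j ∈ Finset.range k, (1 - t ^ (n - 1 - j))) *
      S (n - 1 - k) * (q ^ ((k + 1) * (n - i)) * gaussBinom q i (k + 1)) := by
  induction n generalizing i with
  | zero =>
    obtain rfl : i = 0 := by omega
    simp [h0]
  | succ n ih =>
    induction i with
    | zero => simp [h0, gaussBinom]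
    | succ i ihi =>
      rw [hA n i (by omega), ihi (by omega), ih i (by omega)]
      symm
      rw [← sub_eq_iff_eq_add', ← Finset.sum_sub_distrib]
      -- Pascal's rule: the increment in `i` of the `k`-th term lowers `k + 1` to `k` in the
      -- binomial. The term `k = 0` is then the `S n` part, and the others reassemble `A n i`.
      have e : ∀ k ∈ Finset.range (n + 1),
          t ^ (n + 1 - 1 - k) * (∏ j ∈ Finset.range k, (1 - t ^ (n + 1 - 1 - j))) *
            S (n + 1 - 1 - k) * (q ^ ((k + 1) * (n + 1 - (i + 1))) * gaussBinom q (i + 1) (k + 1)) -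
          t ^ (n + 1 - 1 - k) * (∏ j ∈ Finset.range k, (1 - t ^ (n + 1 - 1 - j))) *
            S (n + 1 - 1 - k) * (q ^ ((k + 1) * (n + 1 - i)) * gaussBinom q i (k + 1)) =
          t ^ (n - k) * (∏ j ∈ Finset.range k, (1 - t ^ (n - j))) *
            S (n - k) * (q ^ ((k + 1) * (n - i)) * gaussBinom q i k) := by
        intro k _
        rw [gaussBinom_succ_succ, show n + 1 - i = (n - i) + 1 by omega,
          show n + 1 - (i + 1) = n - i by omega, Nat.add_sub_cancel, mul_add (k + 1), pow_add]
        ring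
      rw [Finset.sum_congr rfl e, Finset.sum_range_succ']
      simp only [gaussBinom_zero_right]
      rw [add_comm (t ^ n * S n), mul_add, Finset.mul_sum, Finset.mul_sum]
      congr 1
      · refine Finset.sum_congr rfl fun k hk => ?_
        rw [Finset.prod_range_succ']
        rw [show n - 1 - k = n - (k + 1) by omega, add_mul (k + 1) 1, one_mul, pow_add]
        simp only [show ∀ j, n - 1 - j = n - (j + 1) by omega, Nat.sub_zero]
        ring
      · simp
        ring

theorem prod_mul_qPoch (t : R) {n k : ℕ} (h : k ≤ n) :
    (∏ j ∈ Finset.range k, (1 - t ^ (n - j))) * qPoch t t (n - k) = qPoch t t n := by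
  induction k with
  | zero => simp
  | succ k ih =>
    rw [← ih (by omega), Finset.prod_range_succ, show n - k = n - (k + 1) + 1 by omega, qPoch_succ,
      ← pow_succ']
    ring

/-- At `i = n` the powers of `q` in the closed form disappear, and what remains is the desired
convolution with denominators cleared. -/
theorem recurrence_of_partialSum (t q : R) (A : ℕ → ℕ → R) (S : ℕ → R) (h0 : ∀ n, A n 0 = 0)
    (hA : ∀ n i, i ≤ n →
      A (n + 1) (i + 1) = A (n + 1) i + q ^ (n - i) * (t ^ n * S n + (1 - t ^ n) * A n i))
    (hS : ∀ n, A (n + 1) (n + 1) = S (n + 1))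
    (ht : ∀ n, IsUnit (qPoch t t n)) (hq : ∀ n, IsUnit (qPoch q q n)) (c : ℕ → R)
    (hc : ∀ n, c n * (qPoch t t n * qPoch q q n) = S n) (n : ℕ) :
    c n = ∑ p ∈ Finset.HasAntidiagonal.antidiagonal n,
      t ^ p.1 * c p.1 * Ring.inverse (qPoch q q p.2) := by
  rcases n with _ | n
  · simp [qPoch]
  · rw [Finset.Nat.sum_antidiagonal_eq_sum_range_succ
      (fun a b => t ^ a * c a * Ring.inverse (qPoch q q b)), Finset.sum_range_succ, ← sub_eq_iff_eq_add]
    -- Only `(t;t)_n` is needed: moving the term `t^(n+1) c (n+1)` to the left supplies the last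
    -- factor `1 - t^(n+1)`.
    apply ((ht n).mul (hq (n + 1))).mul_right_cancel
    have h := partialSum_eq t q A S h0 hA (n + 1) (n + 1) le_rfl
    rw [hS, ← hc (n + 1)] at h
    simp only [Nat.sub_self, Nat.add_sub_cancel, mul_zero, pow_zero, one_mul] at h
    rw [← Finset.sum_range_reflect, Finset.sum_mul]
    trans c (n + 1) * (qPoch t t (n + 1) * qPoch q q (n + 1))
    · rw [qPoch_succ t, ← pow_succ']
      simp [qPoch]
      ring
    rw [h]
    refine Finset.sum_congr rfl fun k hk => ?_
    have hk : k ≤ n := by simpa [Nat.lt_succ_iff] using hk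
    have e1 := prod_mul_qPoch t hk
    have e2 := gaussBinom_mul_qPoch q (n - k) (k + 1)
    rw [show n - k + (k + 1) = n + 1 by omega] at e2
    have e3 := Ring.inverse_mul_cancel _ (hq (k + 1))
    rw [show n + 1 - 1 - k = n - k by omega, show n + 1 - (n - k) = k + 1 by omega, ← e1, ← e2,
      ← hc (n - k)]
    linear_combination (-(t ^ (n - k) * c (n - k) * (∏ j ∈ Finset.range k, (1 - t ^ (n - j))) *
      qPoch t t (n - k) * gaussBinom q (n + 1) (k + 1) * qPoch q q (n - k))) * e3

end Recurrence

/-! ### Major index and inversions when a last letter is appended -/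

/-- The number of inversions of the word `w 1, …, w n`. -/
def seqInv (n : ℕ) (w : ℕ → ℤ) : ℕ :=
  ∑ j ∈ Finset.Icc 1 n, ∑ i ∈ Finset.Ico 1 j, if w j < w i then 1 else 0

/-- The major index of the word `w 1, …, w n`. -/
def seqMaj (n : ℕ) (w : ℕ → ℤ) : ℕ :=
  ∑ i ∈ (Finset.Ico 1 n).filter fun i => w i > w (i + 1), i

theorem seqInv_succ (n : ℕ) (w : ℕ → ℤ) : seqInv (n + 1) w =
    seqInv n w + ∑ i ∈ Finset.Ico 1 (n + 1), if w (n + 1) < w i then 1 else 0 :=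
  Finset.sum_Icc_succ_top (by omega) _

theorem seqMaj_succ (n : ℕ) (w : ℕ → ℤ) : seqMaj (n + 1) w =
    seqMaj n w + if w (n + 1) < w n then n else 0 := by
  unfold seqMaj
  rcases n with _ | n
  · simp
  · rw [Finset.sum_filter, Finset.sum_filter, Finset.sum_Ico_succ_top (by omega)]

theorem seqInv_congr {n : ℕ} {w w' : ℕ → ℤ}
    (h : ∀ i ∈ Finset.Icc 1 n, ∀ j ∈ Finset.Icc 1 n, w i < w j ↔ w' i < w' j) :
    seqInv n w = seqInv n w' := by
  refine Finset.sum_congr rfl fun j hj => Finset.sum_congr rfl fun i hi => ?_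
  have hi' : i ∈ Finset.Icc 1 n := by
    simp only [Finset.mem_Icc, Finset.mem_Ico] at hi hj ⊢
    omega
  simp only [h j hj i hi']

theorem seqMaj_congr {n : ℕ} {w w' : ℕ → ℤ}
    (h : ∀ i ∈ Finset.Icc 1 n, ∀ j ∈ Finset.Icc 1 n, w i < w j ↔ w' i < w' j) :
    seqMaj n w = seqMaj n w' := by
  refine Finset.sum_congr (Finset.filter_congr fun i hi => ?_) fun _ _ => rfl
  simp only [Finset.mem_Ico] at hi
  exact h _ (by simp; omega) _ (by simp; omega)

/-- The word `σ 0, …, σ (n - 1)`, indexed from `1`. -/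
def permSeq {n : ℕ} (σ : Equiv.Perm (Fin n)) (i : ℕ) : ℤ :=
  if h : i - 1 < n then ((σ ⟨i - 1, h⟩ : ℕ) : ℤ) else 0

theorem permSeq_succ {n : ℕ} (σ : Equiv.Perm (Fin n)) (i : Fin n) :
    permSeq σ (i + 1) = ((σ i : ℕ) : ℤ) := by
  simp [permSeq]

/-- The permutation obtained from `σ` by appending a last letter of relative value `x`. -/
noncomputable def insertLast {n : ℕ} (x : Fin (n + 1)) (σ : Equiv.Perm (Fin n)) :
    Equiv.Perm (Fin (n + 1)) :=
  Equiv.ofBijective (Fin.snoc (α := fun _ => Fin (n + 1)) (fun i => x.succAbove (σ i)) x) <| by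
    rw [← Finite.injective_iff_bijective, Fin.snoc_injective_iff]
    refine ⟨x.succAbove_right_injective.comp σ.injective, ?_⟩
    rintro ⟨i, hi⟩
    exact x.succAbove_ne _ hi

theorem insertLast_last {n : ℕ} (x : Fin (n + 1)) (σ : Equiv.Perm (Fin n)) :
    insertLast x σ (Fin.last n) = x := by
  simp [insertLast]

theorem insertLast_castSucc {n : ℕ} (x : Fin (n + 1)) (σ : Equiv.Perm (Fin n)) (i : Fin n) :
    insertLast x σ i.castSucc = x.succAbove (σ i) := by
  simp [insertLast]

theorem insertLast_bijective (n : ℕ) :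
    Function.Bijective fun p : Fin (n + 1) × Equiv.Perm (Fin n) => insertLast p.1 p.2 := by
  rw [Fintype.bijective_iff_injective_and_card]
  constructor
  · rintro ⟨x, σ⟩ ⟨y, τ⟩ h
    obtain rfl : x = y := by
      have := congrArg (fun π => π (Fin.last n)) h
      simpa [insertLast_last] using this
    have : σ = τ := by
      ext1 i
      have := congrArg (fun π => π i.castSucc) h
      simpa [insertLast_castSucc] using this
    rw [this]
  · simp [Fintype.card_perm, Nat.factorial_succ]

theorem sum_perm_succ {M : Type*} [AddCommMonoid M] {n : ℕ} (F : Equiv.Perm (Fin (n + 1)) → M) :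
    ∑ π, F π = ∑ x : Fin (n + 1), ∑ σ : Equiv.Perm (Fin n), F (insertLast x σ) := by
  rw [← (insertLast_bijective n).sum_comp F, Fintype.sum_prod_type]

theorem permSeq_insertLast_last {n : ℕ} (x : Fin (n + 1)) (σ : Equiv.Perm (Fin n)) :
    permSeq (insertLast x σ) (n + 1) = ((x : ℕ) : ℤ) := by
  have h := permSeq_succ (insertLast x σ) (Fin.last n)
  rwa [insertLast_last] at h

theorem permSeq_insertLast {n : ℕ} (x : Fin (n + 1)) (σ : Equiv.Perm (Fin n)) (i : Fin n) :
    permSeq (insertLast x σ) (i + 1) = ((x.succAbove (σ i) : ℕ) : ℤ) := by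
  rw [← insertLast_castSucc]
  exact permSeq_succ _ i.castSucc

theorem lt_permSeq_insertLast_iff {n : ℕ} (x : Fin (n + 1)) (σ : Equiv.Perm (Fin n)) (i : Fin n) :
    ((x : ℕ) : ℤ) < permSeq (insertLast x σ) (i + 1) ↔ (x : ℕ) ≤ σ i := by
  rw [permSeq_insertLast, Nat.cast_lt, Fin.val_fin_lt, Fin.lt_succAbove_iff_le_castSucc, Fin.le_def]
  rfl

theorem permSeq_insertLast_lt_iff {n : ℕ} (x : Fin (n + 1)) (σ : Equiv.Perm (Fin n))
    (i : ℕ) (hi : i ∈ Finset.Icc 1 n) (j : ℕ) (hj : j ∈ Finset.Icc 1 n) :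
    permSeq (insertLast x σ) i < permSeq (insertLast x σ) j ↔ permSeq σ i < permSeq σ j := by
  simp only [Finset.mem_Icc] at hi hj
  obtain ⟨i', rfl⟩ : ∃ i' : Fin n, i = i' + 1 := ⟨⟨i - 1, by omega⟩, by simp; omega⟩
  obtain ⟨j', rfl⟩ : ∃ j' : Fin n, j = j' + 1 := ⟨⟨j - 1, by omega⟩, by simp; omega⟩
  rw [permSeq_insertLast, permSeq_insertLast, permSeq_succ, permSeq_succ, Nat.cast_lt, Nat.cast_lt,
    Fin.val_fin_lt, Fin.val_fin_lt, Fin.succAbove_lt_succAbove_iff]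

/-- The earlier letters keep their relative order, and exactly `n - x` of them exceed the new one.
-/
theorem seqInv_insertLast {n : ℕ} (x : Fin (n + 1)) (σ : Equiv.Perm (Fin n)) :
    seqInv (n + 1) (permSeq (insertLast x σ)) = seqInv n (permSeq σ) + (n - x) := by
  rw [seqInv_succ, seqInv_congr (permSeq_insertLast_lt_iff x σ), permSeq_insertLast_last]
  congr 1
  rw [Finset.sum_Ico_eq_sum_range]
  simp only [Nat.add_sub_cancel, add_comm 1]
  rw [Finset.sum_range fun i => if ((x : ℕ) : ℤ) < permSeq (insertLast x σ) (i + 1) then 1 else 0]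
  simp only [lt_permSeq_insertLast_iff]
  rw [Equiv.sum_comp σ fun j => if (x : ℕ) ≤ (j : ℕ) then 1 else 0,
    ← Finset.sum_range fun j => if (x : ℕ) ≤ j then 1 else 0, ← Finset.card_filter]
  have : (Finset.range n).filter (fun j => (x : ℕ) ≤ j) = Finset.Ico (x : ℕ) n := by
    ext j
    simp [and_comm]
  rw [this, Nat.card_Ico]

theorem seqMaj_insertLast {n : ℕ} (x : Fin (n + 1)) (σ : Equiv.Perm (Fin n)) :
    seqMaj (n + 1) (permSeq (insertLast x σ)) =
      seqMaj n (permSeq σ) + if permSeq σ n < ((x : ℕ) : ℤ) then 0 else n := by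
  rw [seqMaj_succ, seqMaj_congr (permSeq_insertLast_lt_iff x σ), permSeq_insertLast_last]
  congr 1
  rcases n with _ | n
  · simp
  · have h := lt_permSeq_insertLast_iff x σ (Fin.last n)
    have h' := permSeq_succ σ (Fin.last n)
    simp only [Fin.val_last] at h h'
    simp only [h, h', Nat.cast_lt, ← not_lt, ite_not]

section Weight

variable {R : Type*} [CommRing R] (t q : R)

/-- The weight `t ^ maj σ * q ^ inv σ`. -/
def permWeight {n : ℕ} (σ : Equiv.Perm (Fin n)) : R :=
  t ^ seqMaj n (permSeq σ) * q ^ seqInv n (permSeq σ)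

/-- The polynomial `∑ t ^ maj σ * q ^ inv σ` over the permutations of `n` letters. -/
def genFunS (n : ℕ) : R := ∑ σ : Equiv.Perm (Fin n), permWeight t q σ

/-- The part of `genFunS` coming from permutations with last letter less than `i`. -/
def genFunSLast (n i : ℕ) : R :=
  ∑ σ : Equiv.Perm (Fin n), if permSeq σ n < (i : ℤ) then permWeight t q σ else 0

/-- A descent at `n` is created unless the old last letter is less than `x`; the term `1 - t^n`
corrects for these permutations. -/
theorem sum_permWeight_insertLast {n : ℕ} (x : Fin (n + 1)) :
    ∑ σ : Equiv.Perm (Fin n), permWeight t q (insertLast x σ) =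
      q ^ (n - x : ℕ) * (t ^ n * genFunS t q n + (1 - t ^ n) * genFunSLast t q n x) := by
  rw [genFunS, genFunSLast, Finset.mul_sum, Finset.mul_sum, ← Finset.sum_add_distrib,
    Finset.mul_sum]
  refine Finset.sum_congr rfl fun σ _ => ?_
  rw [permWeight, seqInv_insertLast, seqMaj_insertLast, permWeight]
  split_ifs
  · ring
  · ring

theorem genFunSLast_succ (n i : ℕ) : genFunSLast t q (n + 1) i = ∑ x : Fin (n + 1),
    if (x : ℕ) < i then ∑ σ : Equiv.Perm (Fin n), permWeight t q (insertLast x σ) else 0 := by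
  rw [genFunSLast, sum_perm_succ]
  refine Finset.sum_congr rfl fun x _ => ?_
  simp only [permSeq_insertLast_last, Nat.cast_lt]
  split_ifs <;> simp

theorem genFunSLast_zero_right (n : ℕ) : genFunSLast t q n 0 = 0 := by
  refine Finset.sum_eq_zero fun σ _ => if_neg ?_
  rw [permSeq]
  split_ifs <;> simp

theorem genFunSLast_succ_succ (n i : ℕ) (hi : i ≤ n) : genFunSLast t q (n + 1) (i + 1) =
    genFunSLast t q (n + 1) i +
      q ^ (n - i) * (t ^ n * genFunS t q n + (1 - t ^ n) * genFunSLast t q n i) := by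
  rw [genFunSLast_succ, genFunSLast_succ,
    ← sum_permWeight_insertLast t q (⟨i, Nat.lt_succ_of_le hi⟩ : Fin (n + 1)), ← sub_eq_iff_eq_add',
    ← Finset.sum_sub_distrib]
  rw [Finset.sum_eq_single ⟨i, Nat.lt_succ_of_le hi⟩]
  · simp
  · intro x _ hx
    have : (x : ℕ) ≠ i := fun h => hx (Fin.ext h)
    have : (x : ℕ) < i + 1 ↔ (x : ℕ) < i := by omega
    simp [this]
  · simp

theorem genFunSLast_self (n : ℕ) : genFunSLast t q (n + 1) (n + 1) = genFunS t q (n + 1) := by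
  rw [genFunSLast_succ, genFunS, sum_perm_succ]
  exact Finset.sum_congr rfl fun x _ => if_pos x.2

end Weight

theorem isUnit_qPoch_t (n : ℕ) : IsUnit (qPoch t t n) := isUnit_qPoch (by simp [t]) n

theorem isUnit_qPoch_q (n : ℕ) : IsUnit (qPoch q q n) := isUnit_qPoch (by simp [q]) n

/-- The Roselle identity for the symmetric groups. -/
theorem hasSum_genFunS : IsUnit (biPochInf u t q) ∧
    HasSum (fun n => genFunS t q n * Ring.inverse (qPoch t t n * qPoch q q n) * u ^ n)
      (Ring.inverse (biPochInf u t q)) := by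
  have hc : ∀ n, genFunS t q n * Ring.inverse (qPoch t t n * qPoch q q n) *
      (qPoch t t n * qPoch q q n) = genFunS t q n := fun n => by
    rw [mul_assoc, Ring.inverse_mul_cancel _ ((isUnit_qPoch_t n).mul (isUnit_qPoch_q n)), mul_one]
  apply hasSum_of_recurrence (fun n => genFunS t q n * Ring.inverse (qPoch t t n * qPoch q q n))
  · simp [genFunS, permWeight, qPoch, seqMaj, seqInv]
  · exact recurrence_of_partialSum t q (genFunSLast t q) (genFunS t q) (genFunSLast_zero_right t q)
      (genFunSLast_succ_succ t q) (genFunSLast_self t q) isUnit_qPoch_t isUnit_qPoch_q _ hc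

/-! ### Signed permutations through their windows -/

variable {n : ℕ}

theorem mem_idx {x : ℤ} :
    x ∈ (Finset.Icc (-(n : ℤ)) (n : ℤ)).erase 0 ↔ x ≠ 0 ∧ x.natAbs ≤ n := by
  simp only [Finset.mem_erase, Finset.mem_Icc]
  omega

theorem val_idx (β : B n) (x : Idx n) : val β x.1 = (β.1 x).1 := by
  rw [val, dif_pos x.2]

theorem val_of_mem (β : B n) {i : ℤ} (h : i ∈ (Finset.Icc (-(n : ℤ)) (n : ℤ)).erase 0) :
    val β i = (β.1 ⟨i, h⟩).1 := dif_pos h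

theorem val_of_notMem (β : B n) {i : ℤ} (h : i ∉ (Finset.Icc (-(n : ℤ)) (n : ℤ)).erase 0) :
    val β i = 0 := dif_neg h

theorem val_neg (β : B n) (i : ℤ) : val β (-i) = -val β i := by
  by_cases h : i ∈ (Finset.Icc (-(n : ℤ)) (n : ℤ)).erase 0
  · have := congrArg Subtype.val (β.2 ⟨i, h⟩)
    rw [← val_idx] at this
    rw [val_of_mem β h]
    exact this
  · have h' : -i ∉ (Finset.Icc (-(n : ℤ)) (n : ℤ)).erase 0 := by
      rw [mem_idx] at h ⊢
      simpa using h
    rw [val_of_notMem β h, val_of_notMem β h', neg_zero]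

theorem val_ne_zero (β : B n) {i : ℤ} (h0 : i ≠ 0) (h : i.natAbs ≤ n) : val β i ≠ 0 := by
  rw [val_of_mem β (mem_idx.2 ⟨h0, h⟩)]
  exact (mem_idx.1 (β.1 _).2).1

theorem natAbs_val_le (β : B n) (i : ℤ) : (val β i).natAbs ≤ n := by
  by_cases h : i ∈ (Finset.Icc (-(n : ℤ)) (n : ℤ)).erase 0
  · rw [val_of_mem β h]
    exact (mem_idx.1 (β.1 _).2).2
  · simp [val_of_notMem β h]

theorem val_inj (β : B n) {i j : ℤ} (hi : i.natAbs ≤ n) (hj : j.natAbs ≤ n)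
    (h : val β i = val β j) : i = j := by
  by_cases hi0 : i = 0
  · by_cases hj0 : j = 0
    · rw [hi0, hj0]
    · have := val_ne_zero β hj0 hj
      rw [← h, hi0, val_of_notMem β (by simp)] at this
      exact absurd rfl this
  · by_cases hj0 : j = 0
    · have := val_ne_zero β hi0 hi
      rw [h, hj0, val_of_notMem β (by simp)] at this
      exact absurd rfl this
    · rw [val_of_mem β (mem_idx.2 ⟨hi0, hi⟩), val_of_mem β (mem_idx.2 ⟨hj0, hj⟩)] at h
      exact congrArg Subtype.val (β.1.injective (Subtype.ext h))

theorem val_natAbs_inj (β : B n) {i j : ℕ} (hi : i ≤ n) (hj : j ≤ n)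
    (h : (val β i).natAbs = (val β j).natAbs) : i = j := by
  rcases Int.natAbs_eq_natAbs_iff.1 h with h | h
  · have := val_inj β (by simpa) (by simpa) h
    omega
  · rw [← val_neg] at h
    have := val_inj β (by simpa) (by simpa) h
    omega

theorem val_one (i : ℤ) (h : i.natAbs ≤ n) : val (1 : B n) i = i := by
  by_cases h0 : i = 0
  · rw [h0, val_of_notMem _ (by simp)]
  · rw [val_of_mem _ (mem_idx.2 ⟨h0, h⟩)]
    rfl

theorem val_mul (β γ : B n) (i : ℤ) : val (β * γ) i = val β (val γ i) := by
  by_cases h : i ∈ (Finset.Icc (-(n : ℤ)) (n : ℤ)).erase 0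
  · rw [val_of_mem _ h, val_of_mem γ h, val_idx]
    rfl
  · rw [val_of_notMem _ h, val_of_notMem γ h, val_of_notMem β (by simp)]

theorem ext_val {β γ : B n} (h : ∀ j ∈ Finset.Icc 1 n, val β (j : ℕ) = val γ (j : ℕ)) : β = γ := by
  apply Subtype.ext
  ext x
  rw [← val_idx, ← val_idx]
  obtain ⟨h0, hx⟩ := mem_idx.1 x.2
  have hm : x.1.natAbs ∈ Finset.Icc 1 n := by
    simp only [Finset.mem_Icc]
    omega
  rcases Int.natAbs_eq x.1 with e | e
  · rw [e]
    exact h _ hm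
  · rw [e, val_neg, val_neg, h _ hm]

theorem HasWindow.unique {β γ : B n} {w : ℕ → ℤ} (hβ : HasWindow β w) (hγ : HasWindow γ w) :
    β = γ :=
  ext_val fun j hj => by rw [hβ j hj, hγ j hj]

theorem exists_hasWindow (w : ℕ → ℤ) (h0 : ∀ i ∈ Finset.Icc 1 n, w i ≠ 0 ∧ (w i).natAbs ≤ n)
    (hinj : ∀ i ∈ Finset.Icc 1 n, ∀ j ∈ Finset.Icc 1 n, (w i).natAbs = (w j).natAbs → i = j) :
    ∃ β : B n, HasWindow β w := by
  have hw : ∀ x : Idx n, x.1.sign * w x.1.natAbs ∈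
      (Finset.Icc (-(n : ℤ)) (n : ℤ)).erase 0 := by
    intro x
    obtain ⟨hx0, hx⟩ := mem_idx.1 x.2
    obtain ⟨h1, h2⟩ := h0 x.1.natAbs (by simp only [Finset.mem_Icc]; omega)
    rw [mem_idx, Int.natAbs_mul, Int.natAbs_sign_of_ne_zero hx0, one_mul]
    exact ⟨mul_ne_zero (by simpa using hx0) h1, h2⟩
  -- The odd extension `x ↦ sign x * w |x|` of the window.
  let f : Idx n → Idx n := fun x => ⟨_, hw x⟩
  have hf : Function.Bijective f := by
    rw [← Finite.injective_iff_bijective]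
    intro x y hxy
    have hxy : x.1.sign * w x.1.natAbs = y.1.sign * w y.1.natAbs := congrArg Subtype.val hxy
    obtain ⟨hx0, hx⟩ := mem_idx.1 x.2
    obtain ⟨hy0, hy⟩ := mem_idx.1 y.2
    have hxm : x.1.natAbs ∈ Finset.Icc 1 n := by simp only [Finset.mem_Icc]; omega
    have hym : y.1.natAbs ∈ Finset.Icc 1 n := by simp only [Finset.mem_Icc]; omega
    have hab := congrArg Int.natAbs hxy
    rw [Int.natAbs_mul, Int.natAbs_mul, Int.natAbs_sign_of_ne_zero hx0,
      Int.natAbs_sign_of_ne_zero hy0, one_mul, one_mul] at hab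
    have hab := hinj _ hxm _ hym hab
    rw [hab] at hxy
    have hs := mul_right_cancel₀ (h0 _ hym).1 hxy
    apply Subtype.ext
    rw [← Int.sign_mul_natAbs x.1, ← Int.sign_mul_natAbs y.1, hs, hab]
  refine ⟨⟨Equiv.ofBijective f hf, ?_⟩, ?_⟩
  · intro x
    apply Subtype.ext
    change (-x.1).sign * w (-x.1).natAbs = -(x.1.sign * w x.1.natAbs)
    rw [Int.sign_neg, Int.natAbs_neg, neg_mul]
  · intro j hj
    simp only [Finset.mem_Icc] at hj
    rw [val_of_mem _ (mem_idx.2 ⟨by omega, by simpa using hj.2⟩)]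
    change (j : ℤ).sign * w (j : ℤ).natAbs = w j
    rw [Int.sign_eq_one_of_pos (by omega), one_mul, Int.natAbs_natCast]

/-! ### Decomposition into negative set and relative order -/

/-- The absolute values of the negative entries of the window of `β`. -/
noncomputable def negVals (β : B n) : Finset ℕ :=
  (negPos β).image fun i : ℕ => (val β i).natAbs

theorem mem_negPos {β : B n} {i : ℕ} : i ∈ negPos β ↔ (1 ≤ i ∧ i ≤ n) ∧ val β i < 0 := by
  simp [negPos]

theorem mem_negVals {β : B n} {a : ℕ} :
    a ∈ negVals β ↔ ∃ i, (1 ≤ i ∧ i ≤ n) ∧ val β (i : ℕ) = -(a : ℤ) ∧ 0 < a := by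
  simp only [negVals, Finset.mem_image, mem_negPos]
  constructor
  · rintro ⟨i, ⟨h1, h2⟩, rfl⟩
    exact ⟨i, h1, by omega, by omega⟩
  · rintro ⟨i, h1, h2, h3⟩
    exact ⟨i, ⟨h1, by omega⟩, by omega⟩

theorem sum_negVals {M : Type*} [AddCommMonoid M] (β : B n) (f : ℕ → M) :
    ∑ a ∈ negVals β, f a = ∑ i ∈ negPos β, f (val β (i : ℕ)).natAbs := by
  apply Finset.sum_image
  intro i hi j hj h
  have hi := mem_negPos.1 hi
  have hj := mem_negPos.1 hj
  exact val_natAbs_inj β hi.1.2 hj.1.2 h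

theorem card_negVals (β : B n) : (negVals β).card = N₁ β := by
  rw [Finset.card_eq_sum_ones, sum_negVals, ← Finset.card_eq_sum_ones]
  rfl

theorem negVals_subset (β : B n) : negVals β ⊆ Finset.Icc 1 n := by
  intro a ha
  obtain ⟨i, _, h, h0⟩ := mem_negVals.1 ha
  have := natAbs_val_le β i
  simp only [Finset.mem_Icc]
  omega

/-- The set `{±1, …, ±n}` with the sign of `a` negative exactly for `a ∈ A`. -/
def signedSet (n : ℕ) (A : Finset ℕ) : Finset ℤ :=
  (Finset.Icc 1 n).image fun a => if a ∈ A then -(a : ℤ) else a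

theorem card_signedSet (n : ℕ) (A : Finset ℕ) : (signedSet n A).card = n := by
  rw [signedSet, Finset.card_image_of_injOn, Nat.card_Icc, Nat.add_sub_cancel]
  intro a ha b hb h
  simp only [Finset.coe_Icc, Set.mem_Icc] at ha hb
  simp only at h
  split_ifs at h <;> omega

theorem mem_signedSet {A : Finset ℕ} {v : ℤ} : v ∈ signedSet n A ↔
    v ≠ 0 ∧ v.natAbs ≤ n ∧ (v < 0 ↔ v.natAbs ∈ A) := by
  simp only [signedSet, Finset.mem_image, Finset.mem_Icc]
  constructor
  · rintro ⟨a, ha, rfl⟩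
    split_ifs with h
    · simp [h]
      omega
    · simp [h]
      omega
  · rintro ⟨h0, h1, h2⟩
    refine ⟨v.natAbs, by omega, ?_⟩
    split_ifs with h
    · have := h2.2 h
      omega
    · have := mt h2.1 h
      omega

theorem exists_assemble (A : Finset ℕ) (π : Equiv.Perm (Fin n)) : ∃ β : B n, ∀ i : Fin n,
    val β ((i : ℕ) + 1) = (signedSet n A).orderEmbOfFin (card_signedSet n A) (π i) := by
  set e := (signedSet n A).orderEmbOfFin (card_signedSet n A)
  have he : ∀ i, e i ∈ signedSet n A := Finset.orderEmbOfFin_mem _ _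
  suffices h : ∃ β : B n,
      HasWindow β fun i => if h : i - 1 < n then e (π ⟨i - 1, h⟩) else 0 by
    obtain ⟨β, hβ⟩ := h
    refine ⟨β, fun i => ?_⟩
    have := hβ (i + 1) (by simp)
    simpa using this
  apply exists_hasWindow
  · intro i hi
    simp only [Finset.mem_Icc] at hi
    have := mem_signedSet.1 (he (π ⟨i - 1, by omega⟩))
    rw [dif_pos (show i - 1 < n by omega)]
    exact ⟨this.1, this.2.1⟩
  · intro i hi j hj h
    simp only [Finset.mem_Icc] at hi hj
    rw [dif_pos (show i - 1 < n by omega), dif_pos (show j - 1 < n by omega)] at h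
    have h1 := mem_signedSet.1 (he (π ⟨i - 1, by omega⟩))
    have h2 := mem_signedSet.1 (he (π ⟨j - 1, by omega⟩))
    have h3 : e (π ⟨i - 1, by omega⟩) = e (π ⟨j - 1, by omega⟩) := by
      rw [h] at h1
      have := h1.2.2.trans h2.2.2.symm
      omega
    have := congrArg Fin.val (π.injective (e.injective h3))
    simp only at this
    omega

/-- The signed permutation whose window arranges `signedSet n A` in the relative order `π`. -/
noncomputable def assemble (A : Finset ℕ) (π : Equiv.Perm (Fin n)) : B n :=
  (exists_assemble A π).choose

theorem val_assemble (A : Finset ℕ) (π : Equiv.Perm (Fin n)) (i : Fin n) :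
    val (assemble A π) ((i : ℕ) + 1) =
      (signedSet n A).orderEmbOfFin (card_signedSet n A) (π i) :=
  (exists_assemble A π).choose_spec i

theorem exists_fin_of_mem {i : ℕ} (hi : 1 ≤ i ∧ i ≤ n) : ∃ j : Fin n, i = (j : ℕ) + 1 :=
  ⟨⟨i - 1, by omega⟩, (Nat.sub_add_cancel hi.1).symm⟩

theorem negVals_assemble {A : Finset ℕ} (hA : A ⊆ Finset.Icc 1 n) (π : Equiv.Perm (Fin n)) :
    negVals (assemble A π) = A := by
  ext a
  rw [mem_negVals]
  constructor
  · rintro ⟨i, hi, h, h0⟩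
    obtain ⟨j, rfl⟩ := exists_fin_of_mem hi
    push_cast at h
    rw [val_assemble] at h
    have := mem_signedSet.1 ((signedSet n A).orderEmbOfFin_mem (card_signedSet n A) (π j))
    rw [h] at this
    simpa using this.2.2.1 (by omega)
  · intro ha
    have ha' := Finset.mem_Icc.1 (hA ha)
    have hm : -(a : ℤ) ∈ signedSet n A := by
      rw [mem_signedSet]
      simp [ha]
      omega
    rw [← Finset.mem_coe, ← Finset.range_orderEmbOfFin _ (card_signedSet n A)] at hm
    obtain ⟨j, hj⟩ := hm
    refine ⟨(π.symm j : ℕ) + 1, by omega, ?_, by omega⟩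
    push_cast
    rw [val_assemble, π.apply_symm_apply, hj]

theorem exists_eq_assemble (β : B n) : ∃ π, β = assemble (negVals β) π := by
  have h : ∀ i : Fin n, ∃ j, (signedSet n (negVals β)).orderEmbOfFin
      (card_signedSet n (negVals β)) j = val β ((i : ℕ) + 1) := by
    intro i
    have hi : ((i : ℕ) : ℤ) + 1 = ((i + 1 : ℕ) : ℤ) := by push_cast; rfl
    rw [← Set.mem_range, Finset.range_orderEmbOfFin, Finset.mem_coe, mem_signedSet]
    refine ⟨val_ne_zero β (by omega) (by omega), natAbs_val_le _ _, fun h => ?_, fun h => ?_⟩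
    · rw [mem_negVals]
      exact ⟨i + 1, by omega, by rw [← hi]; omega, by omega⟩
    · obtain ⟨j, hj, h1, h0⟩ := mem_negVals.1 h
      have : j = i + 1 := val_natAbs_inj β hj.2 (by omega) (by rw [h1, ← hi]; omega)
      rw [hi, ← this]
      omega
  choose f hf using h
  have hinj : Function.Injective f := by
    intro i j hij
    have := congrArg ((signedSet n (negVals β)).orderEmbOfFin (card_signedSet n (negVals β))) hij
    rw [hf, hf] at this
    have := val_inj β (by omega) (by omega) this
    exact Fin.ext (by omega)
  refine ⟨Equiv.ofBijective f (Finite.injective_iff_bijective.1 hinj), ext_val fun i hi => ?_⟩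
  obtain ⟨j, rfl⟩ := exists_fin_of_mem (Finset.mem_Icc.1 hi)
  push_cast
  rw [val_assemble, ← hf]
  rfl

theorem assemble_injective (A : Finset ℕ) :
    Function.Injective (assemble A : Equiv.Perm (Fin n) → B n) := by
  intro π σ h
  ext i
  have h := congrArg (fun β => val β ((i : ℕ) + 1)) h
  simp only [val_assemble] at h
  exact congrArg Fin.val (((signedSet n A).orderEmbOfFin (card_signedSet n A)).injective h)

theorem val_assemble_lt_iff (A : Finset ℕ) (π : Equiv.Perm (Fin n)) :
    ∀ i ∈ Finset.Icc 1 n, ∀ j ∈ Finset.Icc 1 n,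
      val (assemble A π) (i : ℕ) < val (assemble A π) (j : ℕ) ↔ permSeq π i < permSeq π j := by
  intro i hi j hj
  obtain ⟨i, rfl⟩ := exists_fin_of_mem (Finset.mem_Icc.1 hi)
  obtain ⟨j, rfl⟩ := exists_fin_of_mem (Finset.mem_Icc.1 hj)
  push_cast
  rw [val_assemble, val_assemble, OrderEmbedding.lt_iff_lt, permSeq_succ, permSeq_succ,
    Nat.cast_lt, Fin.val_fin_lt]

/-- The map `(A, π) ↦ assemble A π` is a bijection onto `B n` under which `G` depends on `A` alone
and the two word statistics on `π` alone. -/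
theorem sum_B_eq {R : Type*} [CommRing R] (t q : R) (G : Finset ℕ → R) :
    ∑ β : B n, G (negVals β) * (t ^ seqMaj n (fun i => val β i) * q ^ seqInv n (fun i => val β i)) =
      (∑ A ∈ (Finset.Icc 1 n).powerset, G A) * genFunS t q n := by
  rw [genFunS, Finset.sum_mul_sum, ← Finset.sum_product']
  symm
  refine Finset.sum_bij (fun p _ => assemble p.1 p.2) (fun _ _ => Finset.mem_univ _) ?_ ?_ ?_
  · rintro ⟨A, π⟩ h ⟨A', π'⟩ h' e
    simp only [Finset.mem_product, Finset.mem_powerset] at h h' e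
    obtain rfl : A = A' := by
      rw [← negVals_assemble h.1 π, e, negVals_assemble h'.1]
    rw [assemble_injective A e]
  · intro β _
    obtain ⟨π, hπ⟩ := exists_eq_assemble β
    exact ⟨(negVals β, π), by simpa using negVals_subset β, hπ.symm⟩
  · rintro ⟨A, π⟩ h
    simp only [Finset.mem_product, Finset.mem_powerset] at h
    rw [negVals_assemble h.1, permWeight, seqMaj_congr (val_assemble_lt_iff A π),
      seqInv_congr (val_assemble_lt_iff A π)]

/-- In `NDes` and `DDes` the positions are coerced to integers by a monadic lift; this turns it into
an ordinary map. -/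
theorem natCast_lift_eq_map (s : Multiset ℕ) :
    (do let a ← s; pure (a : ℤ) : Multiset ℤ) = s.map (fun a : ℕ => (a : ℤ)) :=
  Multiset.bind_singleton s _

theorem nmaj_eq (β : B n) : nmaj β = seqMaj n (fun i => val β i) + ∑ a ∈ negVals β, a := by
  rw [nmaj, NDes, Multiset.sum_add, sum_negVals β fun a => a]
  congr 1
  · rw [seqMaj, Finset.sum_eq_multiset_sum, Multiset.map_id']
    simp only [Nat.cast_add, Nat.cast_one]
    rfl
  · rw [Finset.sum_eq_multiset_sum]
    rw [natCast_lift_eq_map, Multiset.map_map]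
    refine congrArg Multiset.sum (Multiset.map_congr rfl fun i hi => ?_)
    have := (mem_negPos.1 hi).2
    simp only [Function.comp_apply]
    omega

theorem dmaj_eq (β : B n) : dmaj β = seqMaj n (fun i => val β i) + ∑ a ∈ negVals β, (a - 1) := by
  rw [dmaj, DDes, Multiset.sum_add, sum_negVals β fun a => a - 1]
  congr 1
  · rw [seqMaj, Finset.sum_eq_multiset_sum, Multiset.map_id']
    simp only [Nat.cast_add, Nat.cast_one]
    rfl
  · have : ∀ s : Multiset ℕ, (s.filter (· ≠ 0)).sum = s.sum := by
      intro s
      induction s using Multiset.induction with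
      | empty => rfl
      | cons a s ih =>
        rw [Multiset.sum_cons, Multiset.filter_cons, Multiset.sum_add, ih]
        split_ifs with h
        · simp
        · simpa using h
    rw [this, Finset.sum_eq_multiset_sum]
    rw [natCast_lift_eq_map, Multiset.map_map]
    refine congrArg Multiset.sum (Multiset.map_congr rfl fun i hi => ?_)
    have := (mem_negPos.1 hi).2
    simp only [Function.comp_apply]
    omega

/-! ### Coxeter lengths as statistics -/

/-- `hle` bounds word length below by `L`; descending along `hdesc` to `1` gives a word of length at
most `L g`. The predicate `H` allows `D_n` to be treated inside `B_n`. -/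
theorem wordLength_eq {G : Type*} [Group G] {S : Set G} (hS : ∀ s ∈ S, s * s = 1) {L : G → ℕ}
    (h1 : L 1 = 0) (hle : ∀ g, ∀ s ∈ S, L (g * s) ≤ L g + 1) (H : G → Prop)
    (hdesc : ∀ g, H g → g ≠ 1 → ∃ s ∈ S, H (g * s) ∧ L (g * s) < L g) {g : G} (hg : H g) :
    wordLength S g = L g := by
  have lower : ∀ l : List G, (∀ s ∈ l, s ∈ S) → L l.prod ≤ l.length := by
    intro l
    induction l using List.reverseRecOn with
    | nil => simp [h1]
    | append_singleton l s ih =>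
      intro h
      have := ih fun x hx => h x (by simp [hx])
      have := hle l.prod s (h s (by simp))
      simp only [List.prod_append, List.prod_singleton, List.length_append, List.length_singleton]
      omega
  have upper : ∀ k g, L g ≤ k → H g → ∃ l : List G, (∀ s ∈ l, s ∈ S) ∧ l.prod = g ∧
      l.length ≤ L g := by
    intro k
    induction k with
    | zero =>
      intro g hk hg
      by_cases h : g = 1
      · exact ⟨[], by simp, by simp [h], by simp⟩
      · obtain ⟨s, -, -, h⟩ := hdesc g hg h
        omega
    | succ k ih =>
      intro g hk hg
      by_cases h : g = 1
      · exact ⟨[], by simp, by simp [h], by simp⟩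
      · obtain ⟨s, hs, hgs, h⟩ := hdesc g hg h
        obtain ⟨l, hl, hp, hlen⟩ := ih (g * s) (by omega) hgs
        refine ⟨l ++ [s], ?_, ?_, ?_⟩
        · intro x hx
          rcases List.mem_append.1 hx with hx | hx
          · exact hl x hx
          · rw [List.mem_singleton.1 hx]
            exact hs
        · rw [List.prod_append, hp, List.prod_singleton, mul_assoc, hS s hs, mul_one]
        · simp only [List.length_append, List.length_singleton]
          omega
  obtain ⟨l, hl, hp, hlen⟩ := upper _ g le_rfl hg
  apply le_antisymm
  · refine le_trans (Nat.sInf_le ?_) hlen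
    exact ⟨l, hl, hp, rfl⟩
  · obtain ⟨l', hl', hp', hlen'⟩ := Nat.sInf_mem (s := {k | ∃ l : List G, (∀ s ∈ l, s ∈ S) ∧
      l.prod = g ∧ l.length = k}) ⟨_, l, hl, hp, rfl⟩
    rw [wordLength, ← hlen', ← hp']
    exact lower l' hl'

variable {n : ℕ}

/-- The pairs `x < y` in `[-n, n] \ {0}` with `y ≠ -x` that are inverted by `β`. -/
noncomputable def invPairs (β : B n) : Finset (ℤ × ℤ) :=
  (((Finset.Icc (-(n : ℤ)) (n : ℤ)).erase 0) ×ˢ ((Finset.Icc (-(n : ℤ)) (n : ℤ)).erase 0)).filter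
    fun p => p.1 < p.2 ∧ p.1 + p.2 ≠ 0 ∧ val β p.2 < val β p.1

theorem mem_invPairs {β : B n} {p : ℤ × ℤ} : p ∈ invPairs β ↔
    ((p.1 ≠ 0 ∧ p.1.natAbs ≤ n) ∧ (p.2 ≠ 0 ∧ p.2.natAbs ≤ n)) ∧
      p.1 < p.2 ∧ p.1 + p.2 ≠ 0 ∧ val β p.2 < val β p.1 := by
  rw [invPairs, Finset.mem_filter, Finset.mem_product, mem_idx, mem_idx]

theorem sum_idx {M : Type*} [AddCommMonoid M] (n : ℕ) (f : ℤ → M) :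
    ∑ x ∈ (Finset.Icc (-(n : ℤ)) (n : ℤ)).erase 0, f x =
      ∑ i ∈ Finset.Icc 1 n, (f (i : ℕ) + f (-(i : ℕ))) := by
  rw [Finset.sum_add_distrib, ← Finset.sum_filter_add_sum_filter_not _ fun x => 0 < x]
  congr 1
  · refine (Finset.sum_nbij (fun i : ℕ => (i : ℤ)) ?_ ?_ ?_ fun _ _ => rfl).symm
    · intro i hi
      simp only [Finset.mem_Icc, Finset.mem_filter, mem_idx] at hi ⊢
      omega
    · intro i _ j _ h
      exact Int.ofNat_inj.1 h
    · intro x hx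
      simp only [Finset.coe_filter, mem_idx, Set.mem_ofPred_eq] at hx
      exact ⟨x.toNat, by simp; omega, by simp; omega⟩
  · refine (Finset.sum_nbij (fun i : ℕ => -(i : ℤ)) ?_ ?_ ?_ fun _ _ => rfl).symm
    · intro i hi
      simp only [Finset.mem_Icc, Finset.mem_filter, mem_idx] at hi ⊢
      omega
    · intro i _ j _ h
      exact Int.ofNat_inj.1 (neg_injective h)
    · intro x hx
      simp only [Finset.coe_filter, mem_idx, Set.mem_ofPred_eq] at hx
      exact ⟨(-x).toNat, by simp; omega, by simp; omega⟩

theorem image_natAbs_val (β : B n) :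
    (Finset.Icc 1 n).image (fun j : ℕ => (val β j).natAbs) = Finset.Icc 1 n := by
  apply Finset.eq_of_subset_of_card_le
  · intro a ha
    obtain ⟨j, hj, rfl⟩ := Finset.mem_image.1 ha
    rw [Finset.mem_Icc] at hj ⊢
    have := val_ne_zero β (i := j) (by omega) (by omega)
    exact ⟨by omega, natAbs_val_le _ _⟩
  · rw [Finset.card_image_of_injOn]
    intro i hi j hj h
    simp only [Finset.coe_Icc, Set.mem_Icc] at hi hj
    exact val_natAbs_inj β hi.2 hj.2 h

theorem sum_natAbs_val {M : Type*} [AddCommMonoid M] (β : B n) (f : ℕ → M) :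
    ∑ j ∈ Finset.Icc 1 n, f (val β (j : ℕ)).natAbs = ∑ a ∈ Finset.Icc 1 n, f a := by
  conv_rhs => rw [← image_natAbs_val β]
  rw [Finset.sum_image]
  intro i hi j hj h
  simp only [Finset.coe_Icc, Set.mem_Icc] at hi hj
  exact val_natAbs_inj β hi.2 hj.2 h

theorem seqInv_eq_sum_sum (n : ℕ) (w : ℕ → ℤ) : seqInv n w =
    ∑ i ∈ Finset.Icc 1 n, ∑ j ∈ Finset.Icc 1 n, if i < j ∧ w j < w i then 1 else 0 := by
  rw [Finset.sum_comm, seqInv]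
  refine Finset.sum_congr rfl fun j hj => ?_
  rw [Finset.mem_Icc] at hj
  have : Finset.Ico 1 j = (Finset.Icc 1 n).filter fun i => i < j := by
    ext i
    simp only [Finset.mem_Ico, Finset.mem_filter, Finset.mem_Icc]
    omega
  rw [this, Finset.sum_filter]
  refine Finset.sum_congr rfl fun i _ => ?_
  by_cases h : i < j <;> simp [h]

theorem sum_natAbs_lt (β : B n) (i : ℕ) :
    (∑ j ∈ Finset.Icc 1 n, if (val β (j : ℕ)).natAbs < (val β i).natAbs then 1 else 0) =
      (val β i).natAbs - 1 := by
  rw [sum_natAbs_val β fun a => if a < (val β i).natAbs then 1 else 0, ← Finset.card_filter]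
  have h := natAbs_val_le β i
  have : (Finset.Icc 1 n).filter (fun a => a < (val β i).natAbs) =
      Finset.Ico 1 (val β i).natAbs := by
    ext a
    simp only [Finset.mem_Ico, Finset.mem_filter, Finset.mem_Icc]
    omega
  rw [this, Nat.card_Ico]

/-- `β(i) + β(j) < 0` means that the entry of larger absolute value is negative. A negative entry
`-a` dominates `a - 1` others, and ordered pairs count each twice. -/
theorem sum_add_neg (β : B n) :
    (∑ i ∈ Finset.Icc 1 n, ∑ j ∈ Finset.Icc 1 n,
      if i ≠ j ∧ val β (i : ℕ) + val β (j : ℕ) < 0 then 1 else 0) =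
      2 * ∑ a ∈ negVals β, (a - 1) := by
  have h : ∀ i ∈ Finset.Icc 1 n, ∀ j ∈ Finset.Icc 1 n,
      (if i ≠ j ∧ val β (i : ℕ) + val β (j : ℕ) < 0 then 1 else 0) =
      (if val β (i : ℕ) < 0 then
        (if (val β (j : ℕ)).natAbs < (val β (i : ℕ)).natAbs then 1 else 0) else 0) +
      (if val β (j : ℕ) < 0 then
        (if (val β (i : ℕ)).natAbs < (val β (j : ℕ)).natAbs then 1 else 0) else 0) := by
    intro i hi j hj
    rw [Finset.mem_Icc] at hi hj
    by_cases hij : i = j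
    · simp [hij]
    · have := mt (val_natAbs_inj β hi.2 hj.2) hij
      split_ifs <;> omega
  have h2 : (∑ i ∈ Finset.Icc 1 n, ∑ j ∈ Finset.Icc 1 n, (if val β (i : ℕ) < 0 then
        (if (val β (j : ℕ)).natAbs < (val β (i : ℕ)).natAbs then 1 else 0) else 0)) =
      ∑ a ∈ negVals β, (a - 1) := by
    rw [sum_negVals β fun a => a - 1, negPos, Finset.sum_filter]
    refine Finset.sum_congr rfl fun i _ => ?_
    rw [← sum_natAbs_lt β i]
    split_ifs <;> simp
  rw [Finset.sum_congr rfl fun i hi => Finset.sum_congr rfl (h i hi)]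
  simp only [Finset.sum_add_distrib]
  rw [h2, Finset.sum_comm, h2]
  ring

/-- The length function of `D_n`, as a statistic on `B_n`. -/
noncomputable def statD (β : B n) : ℕ :=
  seqInv n (fun i => val β i) + ∑ a ∈ negVals β, (a - 1)

/-- The length function of `B_n`, as a statistic. -/
noncomputable def statB (β : B n) : ℕ :=
  seqInv n (fun i => val β i) + ∑ a ∈ negVals β, a

theorem statB_eq (β : B n) : statB β = statD β + N₁ β := by
  rw [statB, statD, add_assoc, ← card_negVals, Finset.card_eq_sum_ones, ← Finset.sum_add_distrib]
  congr 1
  refine Finset.sum_congr rfl fun a ha => ?_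
  have := Finset.mem_Icc.1 (negVals_subset β ha)
  omega

/-- Pairs of equal sign give the inversions of the window twice; pairs `(-i, j)` give the sum in
`sum_add_neg`. -/
theorem card_invPairs (β : B n) : (invPairs β).card = 2 * statD β := by
  rw [statD, mul_add, ← sum_add_neg, two_mul, invPairs, Finset.card_filter, Finset.sum_product,
    sum_idx]
  simp only [sum_idx, val_neg]
  conv_rhs =>
    enter [1, 2]
    rw [seqInv_eq_sum_sum, Finset.sum_comm]
  rw [seqInv_eq_sum_sum]
  simp only [← Finset.sum_add_distrib]
  refine Finset.sum_congr rfl fun i hi => Finset.sum_congr rfl fun j hj => ?_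
  rw [Finset.mem_Icc] at hi hj
  have e1 : ((i : ℤ) < j ∧ (i : ℤ) + j ≠ 0 ∧ val β j < val β i) ↔
      (i < j ∧ val β j < val β i) := by omega
  have e2 : ¬ ((i : ℤ) < -j ∧ (i : ℤ) + -j ≠ 0 ∧ -val β j < val β i) := by omega
  have e3 : (-(i : ℤ) < j ∧ -(i : ℤ) + j ≠ 0 ∧ val β j < -val β i) ↔
      (i ≠ j ∧ val β i + val β j < 0) := by omega
  have e4 : (-(i : ℤ) < -j ∧ -(i : ℤ) + -j ≠ 0 ∧ -val β j < -val β i) ↔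
      (j < i ∧ val β i < val β j) := by omega
  simp only [e1, e2, e3, e4, if_false]
  ring

theorem val_val_of_mul_self {s : B n} (hs : s * s = 1) {x : ℤ} (hx : x.natAbs ≤ n) :
    val s (val s x) = x := by
  rw [← val_mul, hs, val_one x hx]

/-- The involution `s` applied to both coordinates preserves the order of pairs it does not invert,
and so carries inversions of `β * s` to inversions of `β`. -/
theorem card_invPairs_sdiff_le (β s : B n) (hs : s * s = 1) :
    (invPairs (β * s) \ invPairs s).card ≤ (invPairs β \ invPairs s).card := by
  refine Finset.card_le_card_of_injOn (fun p => (val s p.1, val s p.2)) ?_ ?_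
  · rintro ⟨x, y⟩ h
    simp only [Finset.coe_sdiff, Set.mem_sdiff, Finset.mem_coe, mem_invPairs, val_mul] at h ⊢
    obtain ⟨⟨⟨⟨hx0, hx⟩, hy0, hy⟩, hxy, hxy0, hlt⟩, h2⟩ := h
    rw [val_val_of_mul_self hs hx, val_val_of_mul_self hs hy]
    have hne : val s x ≠ val s y := fun h => hxy.ne (val_inj s hx hy h)
    have hne' : val s x + val s y ≠ 0 := by
      intro h
      have : val s x = val s (-y) := by
        rw [val_neg]
        omega
      have := val_inj s hx (by omega) this
      omega
    refine ⟨⟨⟨⟨val_ne_zero s hx0 hx, natAbs_val_le _ _⟩, val_ne_zero s hy0 hy, natAbs_val_le _ _⟩,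
      ?_, hne', hlt⟩, ?_⟩
    · by_contra h
      exact h2 ⟨⟨⟨hx0, hx⟩, hy0, hy⟩, hxy, hxy0, by omega⟩
    · rintro ⟨-, -, -, h⟩
      omega
  · rintro ⟨x, y⟩ h ⟨x', y'⟩ h' e
    simp only [Finset.coe_sdiff, Set.mem_sdiff, Finset.mem_coe, mem_invPairs] at h h'
    obtain ⟨e1, e2⟩ := Prod.mk.inj e
    rw [val_inj s h.1.1.1.2 h'.1.1.1.2 e1, val_inj s h.1.1.2.2 h'.1.1.2.2 e2]

theorem card_invPairs_sdiff (β s : B n) (hs : s * s = 1) :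
    (invPairs (β * s) \ invPairs s).card = (invPairs β \ invPairs s).card := by
  apply le_antisymm (card_invPairs_sdiff_le β s hs)
  have := card_invPairs_sdiff_le (β * s) s hs
  rwa [mul_assoc, hs, mul_one] at this

/-- Only `(a, b)` and its mirror image change status; both become inverted, so the count rises by
two and its half by one. -/
theorem statD_mul_of_lt {β s : B n} {a b : ℤ} (hs : s * s = 1)
    (hP : invPairs s = {(a, b), (-b, -a)}) (ha : val s a = b) (h : val β a < val β b) :
    statD (β * s) = statD β + 1 := by
  have hab : (a, b) ∈ invPairs s := by simp [hP]
  obtain ⟨⟨⟨ha0, ha'⟩, hb0, hb'⟩, hlt, hne, -⟩ := mem_invPairs.1 hab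
  have hb : val s b = a := by rw [← ha, val_val_of_mul_self hs ha']
  have h1 : invPairs (β * s) ∩ invPairs s = invPairs s := by
    rw [Finset.inter_eq_right, hP]
    intro p hp
    simp only [Finset.mem_insert, Finset.mem_singleton] at hp
    rw [mem_invPairs, val_mul, val_mul]
    rcases hp with rfl | rfl
    · simp only [ha, hb]
      exact ⟨⟨⟨ha0, ha'⟩, hb0, hb'⟩, hlt, hne, h⟩
    · simp only [val_neg, ha, hb]
      omega
  have h2 : invPairs β ∩ invPairs s = ∅ := by
    rw [hP, Finset.eq_empty_iff_forall_notMem]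
    intro p hp
    simp only [Finset.mem_inter, Finset.mem_insert, Finset.mem_singleton, mem_invPairs] at hp
    rcases hp with ⟨hp, rfl | rfl⟩
    · simp only at hp
      omega
    · simp only [val_neg] at hp
      omega
  have h3 : (invPairs s).card = 2 := by
    rw [hP, Finset.card_pair]
    intro e
    have := (Prod.mk.inj e).1
    omega
  have e1 := Finset.card_sdiff_add_card_inter (invPairs (β * s)) (invPairs s)
  have e2 := Finset.card_sdiff_add_card_inter (invPairs β) (invPairs s)
  rw [card_invPairs_sdiff β s hs, h1, h3, card_invPairs] at e1
  rw [h2, Finset.card_empty, card_invPairs] at e2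
  omega

theorem statD_mul_of_gt {β s : B n} {a b : ℤ} (hs : s * s = 1)
    (hP : invPairs s = {(a, b), (-b, -a)}) (ha : val s a = b) (h : val β b < val β a) :
    statD (β * s) + 1 = statD β := by
  have hab : (a, b) ∈ invPairs s := by simp [hP]
  obtain ⟨⟨⟨ha0, ha'⟩, hb0, hb'⟩, hlt, hne, -⟩ := mem_invPairs.1 hab
  have hb : val s b = a := by rw [← ha, val_val_of_mul_self hs ha']
  have := statD_mul_of_lt (β := β * s) hs hP ha (by rwa [val_mul, val_mul, ha, hb])
  rw [mul_assoc, hs, mul_one] at this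
  exact this.symm

theorem statD_mul_le {β s : B n} {a b : ℤ} (hs : s * s = 1)
    (hP : invPairs s = {(a, b), (-b, -a)}) (ha : val s a = b) :
    statD (β * s) ≤ statD β + 1 := by
  rcases le_or_gt (val β b) (val β a) with h | h
  · rcases h.lt_or_eq with h | h
    · have := statD_mul_of_gt hs hP ha h
      omega
    · have hab : (a, b) ∈ invPairs s := by simp [hP]
      obtain ⟨⟨⟨ha0, ha'⟩, hb0, hb'⟩, hlt, hne, -⟩ := mem_invPairs.1 hab
      exact absurd (val_inj β hb' ha' h) hlt.ne'
  · exact (statD_mul_of_lt hs hP ha h).le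

theorem statD_mul_of_invPairs_eq_empty {β s : B n} (hs : s * s = 1) (hP : invPairs s = ∅) :
    statD (β * s) = statD β := by
  have h := card_invPairs_sdiff β s hs
  rw [hP, Finset.sdiff_empty, Finset.sdiff_empty, card_invPairs, card_invPairs] at h
  omega

theorem N₁_eq_sum (β : B n) : N₁ β = ∑ j ∈ Finset.Icc 1 n, if val β (j : ℕ) < 0 then 1 else 0 :=
  Finset.card_filter _ _

/-- Signs multiply: `β(s(j))` is negative when exactly one of `s(j)` and `β(|s(j)|)` is, and the
positions where both are get counted twice on the right. -/
theorem N₁_mul (β s : B n) :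
    N₁ (β * s) + 2 * (∑ j ∈ Finset.Icc 1 n,
      if val s (j : ℕ) < 0 ∧ val β ((val s (j : ℕ)).natAbs : ℕ) < 0 then 1 else 0) =
      N₁ β + N₁ s := by
  have h : N₁ β = ∑ j ∈ Finset.Icc 1 n, if val β ((val s (j : ℕ)).natAbs : ℕ) < 0 then 1 else 0 := by
    rw [sum_natAbs_val s fun a => if val β (a : ℕ) < 0 then 1 else 0]
    exact N₁_eq_sum β
  rw [h, N₁_eq_sum, N₁_eq_sum, Finset.mul_sum, ← Finset.sum_add_distrib, ← Finset.sum_add_distrib]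
  refine Finset.sum_congr rfl fun j hj => ?_
  rw [Finset.mem_Icc] at hj
  have h0 := val_ne_zero s (i := j) (by omega) (by omega)
  have h1 := val_ne_zero β h0 (natAbs_val_le s j)
  rw [val_mul]
  rcases Int.natAbs_eq (val s (j : ℕ)) with e | e
  · rw [← e]
    split_ifs <;> omega
  · have e' : (((val s (j : ℕ)).natAbs : ℕ) : ℤ) = -val s (j : ℕ) := by omega
    rw [e', val_neg]
    split_ifs <;> omega

theorem HasWindow.val_eq {s : B n} {w : ℕ → ℤ} (h : HasWindow s w) {x : ℤ} (h0 : x ≠ 0)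
    (hx : x.natAbs ≤ n) : val s x = if 0 < x then w x.natAbs else -w x.natAbs := by
  have hw := h x.natAbs (by rw [Finset.mem_Icc]; omega)
  split_ifs with hx0
  · rwa [Int.natAbs_of_nonneg hx0.le] at hw
  · rw [← hw, ← val_neg]
    congr 1
    omega

theorem val_adj {i : ℕ} {s : B n} (h : IsAdjTransposition i s) (hi : 1 ≤ i) {x : ℤ} (h0 : x ≠ 0)
    (hx : x.natAbs ≤ n) : val s x =
      if x = i then (i : ℤ) + 1 else if x = i + 1 then (i : ℤ) else
      if x = -i then -((i : ℤ) + 1) else if x = -(i + 1) then -(i : ℤ) else x := by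
  rw [HasWindow.val_eq h h0 hx]
  split_ifs <;> omega

theorem val_zeroB {s : B n} (h : HasWindow s fun j => if j = 1 then -1 else (j : ℤ)) {x : ℤ}
    (h0 : x ≠ 0) (hx : x.natAbs ≤ n) :
    val s x = if x = 1 then -1 else if x = -1 then 1 else x := by
  rw [HasWindow.val_eq h h0 hx]
  split_ifs <;> omega

theorem val_zeroD {s : B n}
    (h : HasWindow s fun j => if j = 1 then -2 else if j = 2 then -1 else (j : ℤ)) {x : ℤ}
    (h0 : x ≠ 0) (hx : x.natAbs ≤ n) : val s x =
      if x = 1 then -2 else if x = 2 then -1 else if x = -1 then 2 else if x = -2 then 1 else x := by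
  rw [HasWindow.val_eq h h0 hx]
  split_ifs <;> omega

theorem mul_self_of_val {s : B n} (h : ∀ j : ℕ, 1 ≤ j → j ≤ n → val s (val s (j : ℕ)) = j) :
    s * s = 1 := by
  refine ext_val fun j hj => ?_
  rw [Finset.mem_Icc] at hj
  rw [val_mul, h j hj.1 hj.2, val_one _ (by simpa using hj.2)]

variable {n : ℕ}

theorem mul_self_adj {i : ℕ} {s : B n} (h : IsAdjTransposition i s) (hi : 1 ≤ i)
    (hi' : i + 1 ≤ n) : s * s = 1 := by
  refine mul_self_of_val fun j hj hj' => ?_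
  have e1 := val_adj h hi (x := j) (by omega) (by omega)
  rw [e1, val_adj h hi (by split_ifs <;> omega) (by split_ifs <;> omega)]
  split_ifs <;> omega

theorem mul_self_zeroB {s : B n} (h : HasWindow s fun j => if j = 1 then -1 else (j : ℤ)) :
    s * s = 1 := by
  refine mul_self_of_val fun j hj hj' => ?_
  have e1 := val_zeroB h (x := j) (by omega) (by omega)
  rw [e1, val_zeroB h (by split_ifs <;> omega) (by split_ifs <;> omega)]
  split_ifs <;> omega

theorem mul_self_zeroD (hn : 2 ≤ n) {s : B n}
    (h : HasWindow s fun j => if j = 1 then -2 else if j = 2 then -1 else (j : ℤ)) :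
    s * s = 1 := by
  refine mul_self_of_val fun j hj hj' => ?_
  have e1 := val_zeroD h (x := j) (by omega) (by omega)
  rw [e1, val_zeroD h (by split_ifs <;> omega) (by split_ifs <;> omega)]
  split_ifs <;> omega

theorem invPairs_adj {i : ℕ} {s : B n} (h : IsAdjTransposition i s) (hi : 1 ≤ i)
    (hi' : i + 1 ≤ n) :
    invPairs s = {((i : ℤ), (i : ℤ) + 1), (-((i : ℤ) + 1), -(i : ℤ))} := by
  ext ⟨x, y⟩
  rw [mem_invPairs]
  simp only [Finset.mem_insert, Finset.mem_singleton, Prod.mk.injEq]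
  by_cases hx : x ≠ 0 ∧ x.natAbs ≤ n
  · by_cases hy : y ≠ 0 ∧ y.natAbs ≤ n
    · rw [val_adj h hi hx.1 hx.2, val_adj h hi hy.1 hy.2]
      split_ifs <;> omega
    · omega
  · omega

/-- The only inverted pair is `(-1, 1)`, which `invPairs` excludes; so this generator affects only
`N₁`. -/
theorem invPairs_zeroB {s : B n} (h : HasWindow s fun j => if j = 1 then -1 else (j : ℤ)) :
    invPairs s = ∅ := by
  rw [Finset.eq_empty_iff_forall_notMem]
  rintro ⟨x, y⟩ hxy
  obtain ⟨⟨hx, hy⟩, h1, h2, h3⟩ := mem_invPairs.1 hxy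
  simp only at hx hy h1 h2 h3
  rw [val_zeroB h hx.1 hx.2, val_zeroB h hy.1 hy.2] at h3
  split_ifs at h3 <;> omega

theorem invPairs_zeroD (hn : 2 ≤ n) {s : B n}
    (h : HasWindow s fun j => if j = 1 then -2 else if j = 2 then -1 else (j : ℤ)) :
    invPairs s = {(-2, 1), (-1, - -2)} := by
  ext ⟨x, y⟩
  rw [mem_invPairs]
  simp only [Finset.mem_insert, Finset.mem_singleton, Prod.mk.injEq]
  by_cases hx : x ≠ 0 ∧ x.natAbs ≤ n
  · by_cases hy : y ≠ 0 ∧ y.natAbs ≤ n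
    · rw [val_zeroD h hx.1 hx.2, val_zeroD h hy.1 hy.2]
      split_ifs <;> omega
    · omega
  · omega

theorem N₁_adj {i : ℕ} {s : B n} (h : IsAdjTransposition i s) (hi : 1 ≤ i) : N₁ s = 0 := by
  rw [N₁, Finset.card_eq_zero, Finset.eq_empty_iff_forall_notMem]
  intro j hj
  obtain ⟨hj, hj'⟩ := mem_negPos.1 hj
  rw [val_adj h hi (by omega) (by omega)] at hj'
  split_ifs at hj' <;> omega

theorem negPos_zeroB (hn : 1 ≤ n) {s : B n}
    (h : HasWindow s fun j => if j = 1 then -1 else (j : ℤ)) : negPos s = {1} := by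
  ext j
  rw [mem_negPos, Finset.mem_singleton]
  by_cases hj : 1 ≤ j ∧ j ≤ n
  · rw [val_zeroB h (by omega) (by omega)]
    split_ifs <;> omega
  · omega

theorem negPos_zeroD (hn : 2 ≤ n) {s : B n}
    (h : HasWindow s fun j => if j = 1 then -2 else if j = 2 then -1 else (j : ℤ)) :
    negPos s = {1, 2} := by
  ext j
  rw [mem_negPos, Finset.mem_insert, Finset.mem_singleton]
  by_cases hj : 1 ≤ j ∧ j ≤ n
  · rw [val_zeroD h (by omega) (by omega)]
    split_ifs <;> omega
  · omega

theorem N₁_mul_adj {i : ℕ} (β : B n) {s : B n} (h : IsAdjTransposition i s) (hi : 1 ≤ i) :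
    N₁ (β * s) = N₁ β := by
  have h1 := N₁_mul β s
  have h2 : (∑ j ∈ Finset.Icc 1 n,
      if val s (j : ℕ) < 0 ∧ val β ((val s (j : ℕ)).natAbs : ℕ) < 0 then 1 else 0) ≤ N₁ s := by
    rw [N₁_eq_sum]
    refine Finset.sum_le_sum fun j _ => ?_
    split_ifs <;> omega
  rw [N₁_adj h hi] at h1 h2
  omega

theorem N₁_mul_zeroB (hn : 1 ≤ n) (β : B n) {s : B n}
    (h : HasWindow s fun j => if j = 1 then -1 else (j : ℤ)) :
    N₁ (β * s) + 2 * (if val β 1 < 0 then 1 else 0) = N₁ β + 1 := by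
  have h1 := N₁_mul β s
  have h2 : N₁ s = 1 := by rw [N₁, negPos_zeroB hn h, Finset.card_singleton]
  rw [h2, Finset.sum_eq_single 1] at h1
  · rw [← h1, val_zeroB h (by simp) (by simpa)]
    simp
  · intro j hj hj1
    rw [Finset.mem_Icc] at hj
    rw [val_zeroB h (by omega) (by omega)]
    refine if_neg fun hj' => ?_
    have := hj'.1
    split_ifs at this <;> omega
  · simp only [Finset.mem_Icc]
    omega

theorem N₁_mul_zeroD (hn : 2 ≤ n) (β : B n) {s : B n}
    (h : HasWindow s fun j => if j = 1 then -2 else if j = 2 then -1 else (j : ℤ)) :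
    N₁ (β * s) % 2 = N₁ β % 2 := by
  have h1 := N₁_mul β s
  have h2 : N₁ s = 2 := by rw [N₁, negPos_zeroD hn h, Finset.card_pair (by norm_num)]
  omega

theorem exists_adj {i : ℕ} (hi : 1 ≤ i) (hi' : i + 1 ≤ n) : ∃ s : B n, IsAdjTransposition i s := by
  apply exists_hasWindow
  · intro j hj
    rw [Finset.mem_Icc] at hj
    split_ifs <;> omega
  · intro j hj k hk h
    rw [Finset.mem_Icc] at hj hk
    split_ifs at h <;> omega

theorem exists_zeroB (n : ℕ) :
    ∃ s : B n, HasWindow s fun j => if j = 1 then -1 else (j : ℤ) := by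
  apply exists_hasWindow
  · intro j hj
    rw [Finset.mem_Icc] at hj
    split_ifs <;> omega
  · intro j hj k hk h
    rw [Finset.mem_Icc] at hj hk
    split_ifs at h <;> omega

theorem exists_zeroD (hn : 2 ≤ n) :
    ∃ s : B n, HasWindow s fun j => if j = 1 then -2 else if j = 2 then -1 else (j : ℤ) := by
  apply exists_hasWindow
  · intro j hj
    rw [Finset.mem_Icc] at hj
    split_ifs <;> omega
  · intro j hj k hk h
    rw [Finset.mem_Icc] at hj hk
    split_ifs at h <;> omega

/-- Strict increase from a first entry at least `1` forces `β(i) ≥ i`; a last entry at most `n`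
forces `β(i) ≤ i`. -/
theorem eq_one_of_increasing {β : B n} (h1 : 1 ≤ n → 0 < val β 1)
    (hinc : ∀ i : ℕ, 1 ≤ i → i + 1 ≤ n → val β i < val β ((i : ℤ) + 1)) : β = 1 := by
  have lower : ∀ i : ℕ, i + 1 ≤ n → (i : ℤ) + 1 ≤ val β ((i : ℤ) + 1) := by
    intro i
    induction i with
    | zero =>
      intro h
      have := h1 h
      rw [Nat.cast_zero, zero_add]
      omega
    | succ i ih =>
      intro h
      have := ih (by omega)
      have := hinc (i + 1) (by omega) h
      push_cast at this ⊢
      omega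
  have upper : ∀ k i : ℕ, i + k = n → 1 ≤ i → val β i ≤ i := by
    intro k
    induction k with
    | zero =>
      intro i hi _
      have := natAbs_val_le β i
      omega
    | succ k ih =>
      intro i hi h1
      have := ih (i + 1) (by omega) (by omega)
      have := hinc i h1 (by omega)
      push_cast at *
      omega
  refine ext_val fun j hj => ?_
  rw [Finset.mem_Icc] at hj
  rw [val_one _ (by simpa using hj.2)]
  have h2 := upper (n - j) j (by omega) hj.1
  obtain ⟨i, rfl⟩ : ∃ i, j = i + 1 := ⟨j - 1, by omega⟩
  have h3 := lower i hj.2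
  push_cast at *
  omega

theorem statD_one : statD (1 : B n) = 0 := by
  have h : invPairs (1 : B n) = ∅ := by
    rw [Finset.eq_empty_iff_forall_notMem]
    intro p hp
    obtain ⟨⟨hx, hy⟩, h1, h2, h3⟩ := mem_invPairs.1 hp
    rw [val_one _ hx.2, val_one _ hy.2] at h3
    omega
  have := card_invPairs (1 : B n)
  rw [h, Finset.card_empty] at this
  omega

theorem N₁_one : N₁ (1 : B n) = 0 := by
  rw [N₁, Finset.card_eq_zero, Finset.eq_empty_iff_forall_notMem]
  intro j hj
  obtain ⟨hj, hj'⟩ := mem_negPos.1 hj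
  rw [val_one _ (by simpa using hj.2)] at hj'
  omega

theorem val_self_adj {i : ℕ} {s : B n} (h : IsAdjTransposition i s) (hi : 1 ≤ i)
    (hi' : i + 1 ≤ n) : val s i = (i : ℤ) + 1 := by
  rw [val_adj h hi (by omega) (by omega), if_pos rfl]

theorem val_neg_two_zeroD (hn : 2 ≤ n) {s : B n}
    (h : HasWindow s fun j => if j = 1 then -2 else if j = 2 then -1 else (j : ℤ)) :
    val s (-2) = 1 := by
  rw [val_zeroD h (by omega) (by omega)]
  norm_num

/-- `ℓ_B = inv + ∑ |β(i)|` over the negative entries. -/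
theorem lengthB_eq (β : B n) : lengthB β = statB β := by
  refine wordLength_eq ?_ (by rw [statB_eq, statD_one, N₁_one]) ?_ (fun _ => True) ?_ trivial
  · rintro s (⟨i, hi, hi', h⟩ | ⟨hn, h⟩)
    · exact mul_self_adj h hi hi'
    · exact mul_self_zeroB h
  · rintro β s (⟨i, hi, hi', h⟩ | ⟨hn, h⟩)
    · have := statD_mul_le (β := β) (mul_self_adj h hi hi') (invPairs_adj h hi hi')
        (val_self_adj h hi hi')
      rw [statB_eq, statB_eq, N₁_mul_adj β h hi]
      omega
    · rw [statB_eq, statB_eq, statD_mul_of_invPairs_eq_empty (mul_self_zeroB h) (invPairs_zeroB h)]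
      have := N₁_mul_zeroB hn β h
      omega
  · intro β _ hβ
    -- If no generator lowers the statistic, the window is increasing and starts with a positive
    -- entry.
    by_contra! hcon
    refine hβ (eq_one_of_increasing (fun hn => ?_) fun i hi hi' => ?_)
    · obtain ⟨s, h⟩ := exists_zeroB n
      have h1 := hcon s (Or.inr ⟨hn, h⟩) trivial
      rw [statB_eq, statB_eq, statD_mul_of_invPairs_eq_empty (mul_self_zeroB h)
        (invPairs_zeroB h)] at h1
      have h2 := N₁_mul_zeroB hn β h
      have h3 := val_ne_zero β (i := 1) (by omega) (by omega)
      split_ifs at h2 <;> omega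
    · obtain ⟨s, h⟩ := exists_adj hi hi'
      have h1 := hcon s (Or.inl ⟨i, hi, hi', h⟩) trivial
      by_contra hlt
      have hne : val β i ≠ val β ((i : ℤ) + 1) := fun e => by
        have := val_inj β (by omega) (by omega) e
        omega
      have := statD_mul_of_gt (β := β) (mul_self_adj h hi hi') (invPairs_adj h hi hi')
        (val_self_adj h hi hi') (by omega)
      rw [statB_eq, statB_eq, N₁_mul_adj β h hi] at h1
      omega

/-- `ℓ_D = inv + ∑ (|γ(i)| - 1)` over the negative entries. -/
theorem lengthD_eq {γ : B n} (hγ : N₁ γ % 2 = 0) : lengthD γ = statD γ := by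
  refine wordLength_eq ?_ statD_one ?_ (fun γ => N₁ γ % 2 = 0) ?_ hγ
  · rintro s (⟨i, hi, hi', h⟩ | ⟨hn, h⟩)
    · exact mul_self_adj h hi hi'
    · exact mul_self_zeroD hn h
  · rintro β s (⟨i, hi, hi', h⟩ | ⟨hn, h⟩)
    · exact statD_mul_le (mul_self_adj h hi hi') (invPairs_adj h hi hi') (val_self_adj h hi hi')
    · exact statD_mul_le (mul_self_zeroD hn h) (invPairs_zeroD hn h) (val_neg_two_zeroD hn h)
  · intro β hβ hβ1
    by_contra! hcon
    have hinc : ∀ i : ℕ, 1 ≤ i → i + 1 ≤ n → val β i < val β ((i : ℤ) + 1) := by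
      intro i hi hi'
      obtain ⟨s, h⟩ := exists_adj hi hi'
      have h1 := hcon s (Or.inl ⟨i, hi, hi', h⟩) (by rwa [N₁_mul_adj β h hi])
      by_contra hlt
      have hne : val β i ≠ val β ((i : ℤ) + 1) := fun e => by
        have := val_inj β (by omega) (by omega) e
        omega
      have := statD_mul_of_gt (β := β) (mul_self_adj h hi hi') (invPairs_adj h hi hi')
        (val_self_adj h hi hi') (by omega)
      omega
    refine hβ1 (eq_one_of_increasing (fun hn => ?_) hinc)
    -- With `β(1) < 0`, failure of `s_0^D` to lower the statistic makes `β(2)` positive, hence all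
    -- later entries too. Then `β` has exactly one negative entry, against parity.
    by_contra hneg
    have h0 := val_ne_zero β (i := 1) (by omega) (by omega)
    have hpos : ∀ i : ℕ, i + 2 ≤ n → 0 < val β ((i : ℤ) + 2) := by
      intro i
      induction i with
      | zero =>
        intro hn2
        obtain ⟨s, h⟩ := exists_zeroD hn2
        have h1 := hcon s (Or.inr ⟨hn2, h⟩) (by rwa [N₁_mul_zeroD hn2 β h])
        by_contra h2
        have hn2 : 2 ≤ n := hn2
        have h3 := val_ne_zero β (i := 2) (by omega) (by omega)
        have h4 : val β 1 < val β (-2) := by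
          rw [val_neg]
          simp only [Nat.cast_zero, zero_add] at h2
          omega
        have := statD_mul_of_gt (β := β) (mul_self_zeroD hn2 h) (invPairs_zeroD hn2 h)
          (val_neg_two_zeroD hn2 h) h4
        omega
      | succ i ih =>
        intro h
        have h1 := ih (by omega)
        have h2 := hinc (i + 2) (by omega) (by omega)
        push_cast at h2 ⊢
        rw [show (i : ℤ) + 1 + 2 = i + 2 + 1 by ring]
        omega
    have : negPos β = {1} := by
      ext j
      rw [mem_negPos, Finset.mem_singleton]
      constructor
      · rintro ⟨hj, hj'⟩
        by_contra hj1
        have := hpos (j - 2) (by omega)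
        rw [show ((j - 2 : ℕ) : ℤ) + 2 = j by omega] at this
        omega
      · rintro rfl
        rw [Nat.cast_one]
        omega
    rw [N₁, this, Finset.card_singleton] at hβ
    omega

/-! ### Summing over negative sets and conclusion -/

section Product

variable {R : Type*} [CommRing R]

theorem sum_powerset_pow (x : R) (n : ℕ) :
    ∑ A ∈ (Finset.Icc 1 n).powerset, x ^ (∑ a ∈ A, a) = qPoch (-x) x n := by
  simp only [← Finset.prod_pow_eq_pow_sum]
  rw [← Finset.prod_add_one, qPoch, Finset.range_eq_Ico,
    ← Finset.prod_Ico_add_right_sub_eq (c := 1)]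
  refine Finset.prod_congr (by ext; simp) fun i hi => ?_
  rw [Finset.mem_Ico] at hi
  have : i = i - 1 + 1 := by omega
  conv_lhs => rw [this, pow_succ']
  ring

/-- The element `1` has exponent `0`, so each subset of `{2, …, n}` extends to exactly one even set
of the same weight. -/
theorem sum_powerset_pow_even (x : R) {n : ℕ} (hn : 1 ≤ n) :
    (∑ A ∈ (Finset.Icc 1 n).powerset,
      if A.card % 2 = 0 then x ^ (∑ a ∈ A, (a - 1)) else 0) = qPoch (-x) x (n - 1) := by
  have h1 : Finset.Icc 1 n = insert 1 (Finset.Icc 2 n) := by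
    ext a
    simp only [Finset.mem_insert, Finset.mem_Icc]
    omega
  have h2 : 1 ∉ Finset.Icc 2 n := by simp
  rw [h1, Finset.sum_powerset_insert h2, ← Finset.sum_add_distrib]
  have h3 : ∀ A ∈ (Finset.Icc 2 n).powerset,
      (if A.card % 2 = 0 then x ^ (∑ a ∈ A, (a - 1)) else 0) +
        (if (insert 1 A).card % 2 = 0 then x ^ (∑ a ∈ insert 1 A, (a - 1)) else 0) =
      ∏ a ∈ A, x ^ (a - 1) := by
    intro A hA
    have h4 : 1 ∉ A := fun h => h2 (Finset.mem_powerset.1 hA h)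
    rw [Finset.card_insert_of_notMem h4, Finset.sum_insert h4, Finset.prod_pow_eq_pow_sum]
    rcases Nat.mod_two_eq_zero_or_one A.card with h | h
    · rw [if_pos h, if_neg (by omega), add_zero]
    · rw [if_neg (by omega), if_pos (by omega), zero_add, Nat.sub_self, zero_add]
  rw [Finset.sum_congr rfl h3, ← Finset.prod_add_one, qPoch, Finset.range_eq_Ico,
    ← Finset.prod_Ico_add_right_sub_eq (c := 2)]
  refine Finset.prod_congr (by ext; simp; omega) fun i hi => ?_
  rw [Finset.mem_Ico] at hi
  have : i - 1 = i - 2 + 1 := by omega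
  rw [this, pow_succ']
  ring

theorem genFunB_eq (n : ℕ) (t q : R) :
    genFunB n t q = qPoch (-(q * t)) (q * t) n * genFunS t q n := by
  rw [← sum_powerset_pow, ← sum_B_eq, genFunB]
  refine Finset.sum_congr rfl fun β _ => ?_
  rw [nmaj_eq, lengthB_eq, statB]
  ring

theorem genFunD_eq {n : ℕ} (hn : 1 ≤ n) (t q : R) :
    genFunD n t q = qPoch (-(q * t)) (q * t) (n - 1) * genFunS t q n := by
  rw [← sum_powerset_pow_even _ hn, ← sum_B_eq t q fun A =>
    if A.card % 2 = 0 then (q * t) ^ (∑ a ∈ A, (a - 1)) else 0, genFunD, D, Finset.sum_filter]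
  refine Finset.sum_congr rfl fun β _ => ?_
  rw [card_negVals]
  split_ifs with h
  · rw [dmaj_eq, lengthD_eq h, statD]
    ring
  · rw [zero_mul]

end Product

theorem isUnit_qPoch_neg (n : ℕ) : IsUnit (qPoch (-(q * t)) (q * t) n) :=
  isUnit_qPoch (by simp [t]) n

theorem mul_inverse_eq {M : Type*} [CommRing M] {a b c s v : M} (ha : IsUnit a) (hb : IsUnit b)
    (hc : IsUnit c) :
    c * s * (v * Ring.inverse (a * b * c)) = s * Ring.inverse (a * b) * v := by
  apply ((ha.mul hb).mul hc).mul_right_cancel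
  have h1 := Ring.inverse_mul_cancel _ ((ha.mul hb).mul hc)
  have h2 := Ring.inverse_mul_cancel _ (ha.mul hb)
  linear_combination c * s * v * h1 - s * v * c * h2

theorem hasSum_genFunB : HasSum (fun n => genFunB n t q * (u ^ n * Ring.inverse (denomB n)))
    (Ring.inverse (biPochInf u t q)) := by
  have h : (fun n => genFunB n t q * (u ^ n * Ring.inverse (denomB n))) =
      fun n => genFunS t q n * Ring.inverse (qPoch t t n * qPoch q q n) * u ^ n :=
    funext fun n => by
      rw [genFunB_eq, denomB,
        mul_inverse_eq (isUnit_qPoch_t n) (isUnit_qPoch_q n) (isUnit_qPoch_neg n)]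
  rw [h]
  exact hasSum_genFunS.2

theorem hasSum_genFunD : HasSum
    (fun n : {n : ℕ // 1 ≤ n} => genFunD n t q * (u ^ (n : ℕ) * Ring.inverse (denomD n)))
    (Ring.inverse (biPochInf u t q) - 1) := by
  have h : (fun n : {n : ℕ // 1 ≤ n} => genFunD n t q * (u ^ (n : ℕ) * Ring.inverse (denomD n))) =
      fun n : {n : ℕ // 1 ≤ n} =>
        genFunS t q n * Ring.inverse (qPoch t t n * qPoch q q n) * u ^ (n : ℕ) :=
    funext fun n => by
      rw [genFunD_eq n.2, denomD,
        mul_inverse_eq (isUnit_qPoch_t n) (isUnit_qPoch_q n) (isUnit_qPoch_neg (n - 1))]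
  -- The indices `n ≥ 1` are the complement of `{0}`, and the omitted term of the series for `S_n`
  -- is `1`.
  rw [h, ← (Equiv.subtypeEquivRight fun n => (by simp; omega :
    n ∉ ({0} : Finset ℕ) ↔ 1 ≤ n)).hasSum_iff]
  refine (Finset.hasSum_compl_iff (f := fun n =>
    genFunS t q n * Ring.inverse (qPoch t t n * qPoch q q n) * u ^ n) {0}).2 ?_
  rw [show Ring.inverse (biPochInf u t q) - 1 + ∑ i ∈ ({0} : Finset ℕ), genFunS t q i *
      Ring.inverse (qPoch t t i * qPoch q q i) * u ^ i = Ring.inverse (biPochInf u t q) by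
    simp [genFunS, permWeight, qPoch, seqMaj, seqInv]]
  exact hasSum_genFunS.2

end SignedPerm

/-- The infinite product and the two series converge in `ℤ⟦t, q, u⟧`, all denominators are
invertible there, and the two identities hold. -/
theorem mainTheorem7 :
    (Multipliable (SignedPerm.biFactor SignedPerm.u SignedPerm.t SignedPerm.q) ∧
      IsUnit (SignedPerm.biPochInf SignedPerm.u SignedPerm.t SignedPerm.q) ∧
      (∀ n : ℕ, IsUnit (SignedPerm.denomB n)) ∧
      (∀ n : ℕ, 1 ≤ n → IsUnit (SignedPerm.denomD n))) ∧
    HasSum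
      (fun n : ℕ => SignedPerm.genFunB n SignedPerm.t SignedPerm.q *
        (SignedPerm.u ^ n * Ring.inverse (SignedPerm.denomB n)))
      (Ring.inverse (SignedPerm.biPochInf SignedPerm.u SignedPerm.t SignedPerm.q)) ∧
    ∃ S : SignedPerm.Ser,
      HasSum
        (fun n : {n : ℕ // 1 ≤ n} => SignedPerm.genFunD n SignedPerm.t SignedPerm.q *
          (SignedPerm.u ^ (n : ℕ) * Ring.inverse (SignedPerm.denomD n))) S ∧
      1 + S = Ring.inverse (SignedPerm.biPochInf SignedPerm.u SignedPerm.t SignedPerm.q) := by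
  open SignedPerm in
  have htq : ∀ n, IsUnit (qPoch t t n * qPoch q q n) :=
    fun n => (isUnit_qPoch_t n).mul (isUnit_qPoch_q n)
  exact ⟨⟨multipliable_biFactor, hasSum_genFunS.1, fun n => (htq n).mul (isUnit_qPoch_neg n),
    fun n _ => (htq n).mul (isUnit_qPoch_neg (n - 1))⟩, hasSum_genFunB,
    Ring.inverse (biPochInf u t q) - 1, hasSum_genFunD, add_sub_cancel _ _⟩
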